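/- Let $\mathbb C\{x,y\}$ be the ring of convergent power series with maximal ideal $\mathfrak m$. For $f\in\mathbb C\{x,y\}$, a *facet* of its Newton boundary $\Gamma(f)$ is a compact one-dimensional face $\Delta$ of the convex hull of $\bigcup_{(i,j)}\big((i,j)+\mathbb R_{\ge 0}^2\big)$, the union taken over all $(i,j)$ such that $x^iy^j$ occurs in $f$. Let $w=w(\Delta)=(w(x),w(y))$ be the normal vector of $\Delta$ with coprime positive integer entries, and let $\operatorname{jet}(f,\Delta)$ be the sum of the terms of $f$ lying on $\Delta$. The germ $f$ is *convenient* if a power of $x$ and a power of $y$ occur in $f$. The *saturation* of a polynomial is obtained by dividing it by the highest possible powers of $x$ and $y$. We say that $f$ has *non-degenerate facets* if, for every facet $\Delta$ of $\Gamma(f)$, the saturation $s$ of $\operatorname{jet}(f,\Delta)$ has finite Milnor number at the origin, i.e. $\dim_{\mathbb C}\mathbb C\{x,y\}/\langle \partial s/\partial x,\partial s/\partial y\rangle<\infty$; $f$ has *non-degenerate Newton boundary* if it is convenient and has non-degenerate facets. A $w$-weighted homogeneous non-unit of $\mathbb C[x,y]$ is called *linear homogeneous* if it has degree one in at least one of the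 two variables, and *non-linear homogeneous* otherwise. We say that $f$ is *normalized with respect to the facet* $\Delta$ if there is a factorization in $\mathbb C[x,y]$ $$\operatorname{jet}(f,\Delta)=x^a\,y^b\,g_1\cdots g_n\,\widetilde g$$ with $a,b,n\ge 0$, where $g_1,\dots,g_n$ are irreducible linear homogeneous polynomials not associated to $x$ or $y$ and $\widetilde g$ is a (possibly empty) product of pairwise non-associated irreducible non-linear homogeneous polynomials, such that, with $w=w(\Delta)$: - if $w(x)=w(y)$, then $a\neq 0$ and $b\neq 0$; - if $w(x)>w(y)$ and $a=0$, then $n=0$; - if $w(x)<w(y)$ and $b=0$, then $n=0$. **Lemma.** Let $f\in\mathfrak m^2\subset\mathbb C\{x,y\}$ be a convenient germ with non-degenerate Newton boundary. Then there is a $\mathbb C$-algebra automorphism $\varphi$ of $\mathbb C\{x,y\}$ such that the germ $\varphi(f)$ (which need not be convenient) has non-degenerate facets and is normalized with respect to every facet of its own Newton boundary $\Gamma(\varphi(f))$. -/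

import Mathlib

/-- A formal power series in two variables over `ℂ` is convergent if it converges absolutely on
some polydisc of positive radius around the origin. -/
def IsConvergent (f : MvPowerSeries (Fin 2) ℂ) : Prop :=
  ∃ r : ℝ, 0 < r ∧ Summable fun m : Fin 2 →₀ ℕ => ‖MvPowerSeries.coeff m f‖ * r ^ m.degree

theorem summable_of_radius_le {f : MvPowerSeries (Fin 2) ℂ} {r s : ℝ} (hs : 0 ≤ s) (hsr : s ≤ r)
    (h : Summable fun m : Fin 2 →₀ ℕ => ‖MvPowerSeries.coeff m f‖ * r ^ m.degree) :
    Summable fun m : Fin 2 →₀ ℕ => ‖MvPowerSeries.coeff m f‖ * s ^ m.degree :=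
  h.of_nonneg_of_le (fun _ => by positivity) (fun _ => by gcongr)

theorem isConvergent_add {f g : MvPowerSeries (Fin 2) ℂ} (hf : IsConvergent f)
    (hg : IsConvergent g) : IsConvergent (f + g) := by
  obtain ⟨r, hr, hf⟩ := hf
  obtain ⟨s, hs, hg⟩ := hg
  refine ⟨min r s, lt_min hr hs, ?_⟩
  have hp : 0 ≤ min r s := (lt_min hr hs).le
  refine ((summable_of_radius_le hp (min_le_left _ _) hf).add
    (summable_of_radius_le hp (min_le_right _ _) hg)).of_nonneg_of_le
      (fun _ => by positivity) (fun m => ?_)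
  rw [map_add, ← add_mul]
  gcongr
  exact norm_add_le _ _

theorem isConvergent_mul {f g : MvPowerSeries (Fin 2) ℂ} (hf : IsConvergent f)
    (hg : IsConvergent g) : IsConvergent (f * g) := by
  obtain ⟨r, hr, hf⟩ := hf
  obtain ⟨s, hs, hg⟩ := hg
  have hp : 0 ≤ min r s := (lt_min hr hs).le
  refine ⟨min r s, lt_min hr hs, ?_⟩
  have h1 := summable_of_radius_le hp (min_le_left _ _) hf
  have h2 := summable_of_radius_le hp (min_le_right _ _) hg
  have h3 := summable_sum_mul_antidiagonal_of_summable_mul (A := Fin 2 →₀ ℕ)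
    (f := fun m => ‖MvPowerSeries.coeff m f‖ * min r s ^ m.degree)
    (g := fun m => ‖MvPowerSeries.coeff m g‖ * min r s ^ m.degree)
    (h1.mul_of_nonneg h2 (fun m => mul_nonneg (norm_nonneg _) (pow_nonneg hp _))
      (fun m => mul_nonneg (norm_nonneg _) (pow_nonneg hp _)))
  refine h3.of_nonneg_of_le (fun m => mul_nonneg (norm_nonneg _) (pow_nonneg hp _)) (fun m => ?_)
  rw [MvPowerSeries.coeff_mul]
  refine (mul_le_mul_of_nonneg_right (norm_sum_le _ _) (pow_nonneg hp _)).trans ?_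
  rw [Finset.sum_mul]
  refine Finset.sum_le_sum fun p hpm => le_of_eq ?_
  rw [Finset.HasAntidiagonal.mem_antidiagonal] at hpm
  rw [norm_mul, ← hpm, map_add, pow_add]
  ring

theorem isConvergent_coe (p : MvPolynomial (Fin 2) ℂ) :
    IsConvergent (p : MvPowerSeries (Fin 2) ℂ) := by
  refine ⟨1, one_pos, summable_of_ne_finset_zero (s := p.support) fun m hm => ?_⟩
  rw [MvPolynomial.coeff_coe, MvPolynomial.notMem_support_iff.mp hm, norm_zero, zero_mul]

theorem isConvergent_pderiv (i : Fin 2) {f : MvPowerSeries (Fin 2) ℂ} (hf : IsConvergent f) :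
    IsConvergent (MvPowerSeries.pderiv ℂ i f) := by
  obtain ⟨r, hr, hf⟩ := hf
  refine ⟨r / 2, half_pos hr, ?_⟩
  have hinj : Function.Injective fun m : Fin 2 →₀ ℕ => m + Finsupp.single i 1 :=
    add_left_injective _
  refine ((hf.comp_injective hinj).mul_left (2 / r)).of_nonneg_of_le
    (fun _ => by positivity) (fun m => ?_)
  have h1 : (m i : ℝ) + 1 ≤ 2 ^ (m.degree + 1) := by
    have h2 : m i + 1 ≤ m.degree + 1 := Nat.succ_le_succ (Finsupp.le_degree i m)
    exact_mod_cast h2.trans Nat.lt_two_pow_self.le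
  have h4 : ‖(m i : ℂ) + 1‖ = (m i : ℝ) + 1 := by
    rw [← Nat.cast_succ, Complex.norm_natCast, Nat.cast_succ]
  rw [MvPowerSeries.coeff_pderiv, norm_mul, h4]
  simp only [Function.comp_apply, map_add, Finsupp.degree_single]
  set c := ‖MvPowerSeries.coeff (m + Finsupp.single i 1) f‖
  calc c * ((m i : ℝ) + 1) * (r / 2) ^ m.degree
      ≤ c * 2 ^ (m.degree + 1) * (r / 2) ^ m.degree := by gcongr
    _ = 2 / r * (c * r ^ (m.degree + 1)) := by
        rw [div_pow, pow_succ, pow_succ]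
        field_simp

/-- The ring `ℂ{x, y}` of convergent power series; `x` is the variable `0`, `y` the variable `1`. -/
def ConvergentSeries : Subalgebra ℂ (MvPowerSeries (Fin 2) ℂ) where
  carrier := {f | IsConvergent f}
  mul_mem' := isConvergent_mul
  add_mem' := isConvergent_add
  algebraMap_mem' c := by
    have h := isConvergent_coe (MvPolynomial.C c)
    rwa [MvPolynomial.coe_C] at h

namespace ConvergentSeries

/-- The germ at the origin of a polynomial. -/
def ofPoly (p : MvPolynomial (Fin 2) ℂ) : ConvergentSeries := ⟨p, isConvergent_coe p⟩

/-- The partial derivative of a germ with respect to the `i`-th variable. -/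
noncomputable def partialDeriv (i : Fin 2) (f : ConvergentSeries) : ConvergentSeries :=
  ⟨MvPowerSeries.pderiv ℂ i f, isConvergent_pderiv i f.2⟩

/-- The maximal ideal `𝔪` of `ℂ{x, y}`: the germs vanishing at the origin. -/
noncomputable def maxIdeal : Ideal ConvergentSeries :=
  RingHom.ker ((MvPowerSeries.constantCoeff (σ := Fin 2) (R := ℂ)).comp
    ConvergentSeries.val.toRingHom)

/-- The Jacobian ideal of a germ. -/
noncomputable def jacobianIdeal (f : ConvergentSeries) : Ideal ConvergentSeries :=
  Ideal.span (Set.range fun i => partialDeriv i f)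

/-- The Milnor number `dim_ℂ ℂ{x, y} / Jac(f)` is finite. -/
def HasFiniteMilnorNumber (f : ConvergentSeries) : Prop :=
  Module.Finite ℂ (ConvergentSeries ⧸ jacobianIdeal f)

/-- The point of the plane with the coordinates of an exponent vector. -/
def exponentPoint (m : Fin 2 →₀ ℕ) : Fin 2 → ℝ := fun i => (m i : ℝ)

/-- The convex hull of the union of the quadrants `m + ℝ²_{≥0}`, `m` in the support of `f`. -/
def newtonPolyhedron (f : ConvergentSeries) : Set (Fin 2 → ℝ) :=
  convexHull ℝ {p | ∃ m : Fin 2 →₀ ℕ,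
    MvPowerSeries.coeff m (f : MvPowerSeries (Fin 2) ℂ) ≠ 0 ∧ exponentPoint m ≤ p}

/-- A facet of the Newton boundary: a compact one-dimensional face of the Newton polyhedron.
(A compact face with more than one point is neither a vertex nor the whole polyhedron.) -/
def IsFacet (f : ConvergentSeries) (Δ : Set (Fin 2 → ℝ)) : Prop :=
  IsExposed ℝ (newtonPolyhedron f) Δ ∧ IsCompact Δ ∧ Δ.Nontrivial

/-- `w` is the weight of the segment `Δ`: it has positive integer entries without common factor
and is normal to `Δ`. -/
def IsWeightOf (w : Fin 2 → ℕ) (Δ : Set (Fin 2 → ℝ)) : Prop :=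
  0 < w 0 ∧ 0 < w 1 ∧ (w 0).Coprime (w 1) ∧
    ∀ p ∈ Δ, ∀ q ∈ Δ, (w 0 : ℝ) * p 0 + w 1 * p 1 = w 0 * q 0 + w 1 * q 1

open Classical in
/-- `jet(f, Δ)`: the sum of the terms of `f` lying on `Δ`, a finite sum for bounded `Δ`. -/
noncomputable def facetJet (f : ConvergentSeries) (Δ : Set (Fin 2 → ℝ)) :
    MvPolynomial (Fin 2) ℂ :=
  ∑ᶠ m : Fin 2 →₀ ℕ, if exponentPoint m ∈ Δ then
    MvPolynomial.monomial m (MvPowerSeries.coeff m (f : MvPowerSeries (Fin 2) ℂ)) else 0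

/-- `h` is the saturation of `g`: `g = x ^ k * y ^ l * h` with `k`, `l` maximal. -/
def IsSaturation (g h : MvPolynomial (Fin 2) ℂ) : Prop :=
  (∃ k l : ℕ, g = MvPolynomial.X 0 ^ k * MvPolynomial.X 1 ^ l * h) ∧
    ¬ MvPolynomial.X 0 ∣ h ∧ ¬ MvPolynomial.X 1 ∣ h

/-- The Newton boundary meets both coordinate axes, that is, a power of each of the two variables
occurs in `f`. -/
def IsConvenient (f : ConvergentSeries) : Prop :=
  ∀ i : Fin 2, ∃ k : ℕ,
    MvPowerSeries.coeff (Finsupp.single i k) (f : MvPowerSeries (Fin 2) ℂ) ≠ 0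

/-- For every facet, the saturation of the jet of `f` has finite Milnor number. -/
def HasNondegenerateFacets (f : ConvergentSeries) : Prop :=
  ∀ Δ, IsFacet f Δ → ∃ h, IsSaturation (facetJet f Δ) h ∧ HasFiniteMilnorNumber (ofPoly h)

/-- `f` is convenient with non-degenerate Newton boundary. -/
def HasNondegenerateNewtonBoundary (f : ConvergentSeries) : Prop :=
  IsConvenient f ∧ HasNondegenerateFacets f

/-- A non-unit that is weighted homogeneous with respect to `w`. -/
def IsHomogeneousNonunit (w : Fin 2 → ℕ) (p : MvPolynomial (Fin 2) ℂ) : Prop :=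
  ¬ IsUnit p ∧ ∃ d : ℕ, MvPolynomial.IsWeightedHomogeneous w p d

/-- The polynomial has degree one in at least one of the two variables. -/
def IsLinearInOneVariable (p : MvPolynomial (Fin 2) ℂ) : Prop :=
  p.degreeOf 0 = 1 ∨ p.degreeOf 1 = 1

/-- `g = x ^ a * y ^ b * g₁ ⋯ gₙ * (h₁ ⋯ hₖ)` is the factorization of a `w`-weighted homogeneous
polynomial, where the `gᵢ` are the linear homogeneous irreducible factors not associated to `x` or
`y` and the `hᵢ` are pairwise non-associated non-linear homogeneous irreducible factors. -/
def IsFactorization (w : Fin 2 → ℕ) (g : MvPolynomial (Fin 2) ℂ) (a b : ℕ)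
    (gs hs : List (MvPolynomial (Fin 2) ℂ)) : Prop :=
  g = MvPolynomial.X 0 ^ a * MvPolynomial.X 1 ^ b * gs.prod * hs.prod ∧
    (∀ p ∈ gs, Irreducible p ∧ IsHomogeneousNonunit w p ∧ IsLinearInOneVariable p ∧
      ¬ Associated p (MvPolynomial.X 0) ∧ ¬ Associated p (MvPolynomial.X 1)) ∧
    (∀ p ∈ hs, Irreducible p ∧ IsHomogeneousNonunit w p ∧ ¬ IsLinearInOneVariable p) ∧
    hs.Pairwise fun p q => ¬ Associated p q

/-- `f` is normalized with respect to the facet `Δ`. The numbers `a`, `b` and `n = gs.length` in the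
factorization are unique. -/
def IsNormalizedAt (f : ConvergentSeries) (Δ : Set (Fin 2 → ℝ)) : Prop :=
  ∃ w : Fin 2 → ℕ, IsWeightOf w Δ ∧ ∃ (a b : ℕ) (gs hs : List (MvPolynomial (Fin 2) ℂ)),
    IsFactorization w (facetJet f Δ) a b gs hs ∧
      (w 0 = w 1 → a ≠ 0 ∧ b ≠ 0) ∧
      (w 1 < w 0 → a = 0 → gs.length = 0) ∧
      (w 0 < w 1 → b = 0 → gs.length = 0)

/-- The germs `f` and `g` are transformed into each other by a `ℂ`-algebra automorphism of
`ℂ{x, y}`. -/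
def RightEquivalent (f g : ConvergentSeries) : Prop :=
  ∃ φ : ConvergentSeries ≃ₐ[ℂ] ConvergentSeries, φ f = g

end ConvergentSeries

/-! Write x_i, x_j for the two variables in either order. By quasi-homogeneity, a saturated facet
jet with finite Milnor number has no critical point away from the origin
(`exists_eval_pderiv_ne_zero`), since otherwise a whole weighted orbit would be critical. Such a jet
is therefore squarefree, so its non-linear irreducible factors are pairwise non-associated. What
remains of normalization is a condition on linear factors.

An irreducible linear factor other than x and y contains a pure power of each variable, and
coprimality of the weights then forces one of them to be 1 (`weight_eq_one_of_degreeOf_eq_one`).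
Normalization can thus fail only on a facet with w_j = 1 whose jet is not divisible by x_i; for w =
(1,1) this is exactly the failure. This is `HasSmoothFacetAt`, and without such facets every facet
is normalized (`isNormalizedAt_of_not_hasSmoothFacetAt`).

Such facets can be removed. With α = w_i, the jet has a simple zero (c, 1), which the implicit
function theorem, applied after a weighted blow-up, lifts to a smooth branch x_i = φ(x_j) = x_j^α (c
+ u(x_j)) of the germ (`exists_smooth_branch`). The automorphism x_i ↦ x_i + φ(x_j) makes the germ
divisible by x_i, which rules out a smooth facet on that side for good.

Non-degeneracy survives the shear (`exists_straightening`). For weights w' with w'_i < α w'_j the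
shear is of higher order, so facet and jet do not change. For w' = w the new saturation s satisfies
x_i s = (old saturation after the polynomial shear), and Euler's relation bounds its Milnor number
by the old one. For w'_i > α w'_j there is no facet, because a monomial linear in x_i lies on the
w-line. The shear also preserves divisibility by x_j, so treating each variable at most once
suffices. -/

namespace ConvergentSeries

/-! ### Weight filtrations, weighted jets and their behaviour under substitution. -/

open MvPowerSeries

/-- The ideal of the power series all of whose terms have weight at least `d`. -/
def weightIdeal (w : Fin 2 → ℕ) (d : ℕ) : Ideal (MvPowerSeries (Fin 2) ℂ) where
  carrier := {f | ∀ m, coeff m f ≠ 0 → d ≤ Finsupp.weight w m}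
  zero_mem' m hm := by simp at hm
  add_mem' {f g} hf hg m hm := by
    by_contra h
    have h1 : coeff m f = 0 := by_contra fun h' => h (hf m h')
    have h2 : coeff m g = 0 := by_contra fun h' => h (hg m h')
    simp [h1, h2] at hm
  smul_mem' g f hf m hm := by
    rw [smul_eq_mul, coeff_mul] at hm
    obtain ⟨p, hp, hne⟩ := Finset.exists_ne_zero_of_sum_ne_zero hm
    rw [Finset.HasAntidiagonal.mem_antidiagonal] at hp
    rw [← hp, map_add]
    exact (hf _ (right_ne_zero_of_mul hne)).trans (Nat.le_add_left _ _)

theorem mem_weightIdeal {w : Fin 2 → ℕ} {d : ℕ} {f : MvPowerSeries (Fin 2) ℂ} :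
    f ∈ weightIdeal w d ↔ ∀ m, coeff m f ≠ 0 → d ≤ Finsupp.weight w m := Iff.rfl

theorem coeff_eq_zero_of_mem_weightIdeal {w : Fin 2 → ℕ} {d : ℕ} {f : MvPowerSeries (Fin 2) ℂ}
    (hf : f ∈ weightIdeal w d) {m : Fin 2 →₀ ℕ} (hm : Finsupp.weight w m < d) : coeff m f = 0 :=
  by_contra fun h => absurd (hf m h) (not_le.mpr hm)

theorem weightIdeal_anti {w : Fin 2 → ℕ} {d e : ℕ} (h : d ≤ e) :
    weightIdeal w e ≤ weightIdeal w d := fun _ hf m hm => h.trans (hf m hm)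

theorem mem_weightIdeal_zero (w : Fin 2 → ℕ) (f : MvPowerSeries (Fin 2) ℂ) :
    f ∈ weightIdeal w 0 := fun _ _ => Nat.zero_le _

theorem mul_mem_weightIdeal {w : Fin 2 → ℕ} {d e : ℕ} {f g : MvPowerSeries (Fin 2) ℂ}
    (hf : f ∈ weightIdeal w d) (hg : g ∈ weightIdeal w e) : f * g ∈ weightIdeal w (d + e) := by
  intro m hm
  rw [coeff_mul] at hm
  obtain ⟨p, hp, hne⟩ := Finset.exists_ne_zero_of_sum_ne_zero hm
  rw [Finset.HasAntidiagonal.mem_antidiagonal] at hp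
  rw [← hp, map_add]
  exact add_le_add (hf _ (left_ne_zero_of_mul hne)) (hg _ (right_ne_zero_of_mul hne))

theorem pow_mem_weightIdeal {w : Fin 2 → ℕ} {d : ℕ} {f : MvPowerSeries (Fin 2) ℂ}
    (hf : f ∈ weightIdeal w d) (n : ℕ) : f ^ n ∈ weightIdeal w (n * d) := by
  induction n with
  | zero => simpa using mem_weightIdeal_zero w _
  | succ n ih => rw [pow_succ, Nat.succ_mul]; exact mul_mem_weightIdeal ih hf

theorem monomial_mem_weightIdeal {w : Fin 2 → ℕ} {d : ℕ} {m : Fin 2 →₀ ℕ}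
    (h : d ≤ Finsupp.weight w m) (c : ℂ) : monomial m c ∈ weightIdeal w d := by
  classical
  intro n hn
  rw [coeff_monomial] at hn
  obtain rfl : n = m := by_contra fun h => hn (if_neg h)
  exact h

theorem X_mem_weightIdeal (w : Fin 2 → ℕ) (k : Fin 2) :
    (X k : MvPowerSeries (Fin 2) ℂ) ∈ weightIdeal w (w k) :=
  monomial_mem_weightIdeal (by simp [Finsupp.weight_single]) 1

theorem C_mul_mem_weightIdeal {w : Fin 2 → ℕ} {d : ℕ} {f : MvPowerSeries (Fin 2) ℂ}
    (c : ℂ) (hf : f ∈ weightIdeal w d) : C c * f ∈ weightIdeal w d := Ideal.mul_mem_left _ _ hf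

/-- Stating this for an arbitrary ordered pair i ≠ j lets later arguments treat both axes at once: i
is the variable being sheared, j the other one. -/
theorem weight_fin_two (w : Fin 2 → ℕ) (m : Fin 2 →₀ ℕ) {i j : Fin 2} (hij : i ≠ j) :
    Finsupp.weight w m = w i * m i + w j * m j := by
  have h : Finsupp.weight w m = w 0 * m 0 + w 1 * m 1 := by
    rw [Finsupp.weight_apply, Finsupp.sum_fintype _ _ (by simp), Fin.sum_univ_two]
    simp [mul_comm]
  rw [h]
  fin_cases i <;> fin_cases j <;> simp_all [add_comm]

theorem prod_fin_two {M : Type*} [CommMonoid M] (a : Fin 2 → M) (m : Fin 2 →₀ ℕ) {i j : Fin 2}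
    (hij : i ≠ j) : (m.prod fun k n => a k ^ n) = a i ^ m i * a j ^ m j := by
  rw [Finsupp.prod_fintype _ _ (by simp), Fin.prod_univ_two]
  fin_cases i <;> fin_cases j <;> simp_all [mul_comm]

theorem finsupp_ext_fin_two {m n : Fin 2 →₀ ℕ} {i j : Fin 2} (hij : i ≠ j) (h1 : m i = n i)
    (h2 : m j = n j) : m = n := by
  ext k
  have : k = i ∨ k = j := by omega
  rcases this with rfl | rfl <;> assumption

theorem prod_mem_weightIdeal {w v : Fin 2 → ℕ} {a : Fin 2 → MvPowerSeries (Fin 2) ℂ}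
    (ha : ∀ k, a k ∈ weightIdeal w (v k)) (m : Fin 2 →₀ ℕ) :
    (m.prod fun k n => a k ^ n) ∈ weightIdeal w (Finsupp.weight v m) := by
  rw [prod_fin_two a m zero_ne_one, weight_fin_two v m zero_ne_one, mul_comm (v 0), mul_comm (v 1)]
  exact mul_mem_weightIdeal (pow_mem_weightIdeal (ha 0) _) (pow_mem_weightIdeal (ha 1) _)

/-- Congruence modulo higher weight is multiplicative. -/
theorem mul_sub_mul_mem_weightIdeal {w : Fin 2 → ℕ} {d e : ℕ} {f f' g g' : MvPowerSeries (Fin 2) ℂ}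
    (hf : f - f' ∈ weightIdeal w (d + 1)) (hg : g - g' ∈ weightIdeal w (e + 1))
    (hf' : f' ∈ weightIdeal w d) (hg0 : g ∈ weightIdeal w e) :
    f * g - f' * g' ∈ weightIdeal w (d + e + 1) := by
  have h : f * g - f' * g' = (f - f') * g + f' * (g - g') := by ring
  rw [h]
  refine add_mem ?_ ?_
  · have := mul_mem_weightIdeal hf hg0
    rwa [add_right_comm] at this
  · have := mul_mem_weightIdeal hf' hg
    rwa [← add_assoc] at this

theorem pow_sub_pow_mem_weightIdeal {w : Fin 2 → ℕ} {d : ℕ} {f f' : MvPowerSeries (Fin 2) ℂ}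
    (hf : f - f' ∈ weightIdeal w (d + 1)) (hf0 : f ∈ weightIdeal w d)
    (hf' : f' ∈ weightIdeal w d) (n : ℕ) :
    f ^ n - f' ^ n ∈ weightIdeal w (n * d + 1) := by
  induction n with
  | zero => simp
  | succ n ih =>
    rw [pow_succ, pow_succ, Nat.succ_mul]
    exact mul_sub_mul_mem_weightIdeal ih hf (pow_mem_weightIdeal hf' _) hf0

theorem prod_sub_prod_mem_weightIdeal {w v : Fin 2 → ℕ} {a b : Fin 2 → MvPowerSeries (Fin 2) ℂ}
    (ha : ∀ k, a k ∈ weightIdeal w (v k)) (hb : ∀ k, b k ∈ weightIdeal w (v k))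
    (hab : ∀ k, a k - b k ∈ weightIdeal w (v k + 1)) (m : Fin 2 →₀ ℕ) :
    (m.prod fun k n => a k ^ n) - (m.prod fun k n => b k ^ n) ∈
      weightIdeal w (Finsupp.weight v m + 1) := by
  rw [prod_fin_two a m zero_ne_one, prod_fin_two b m zero_ne_one, weight_fin_two v m zero_ne_one,
    mul_comm (v 0), mul_comm (v 1)]
  exact mul_sub_mul_mem_weightIdeal (pow_sub_pow_mem_weightIdeal (hab 0) (ha 0) (hb 0) _)
    (pow_sub_pow_mem_weightIdeal (hab 1) (ha 1) (hb 1) _) (pow_mem_weightIdeal (hb 0) _)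
    (pow_mem_weightIdeal (ha 1) _)

/-- A termwise criterion for the congruence of two substitutions. -/
theorem subst_sub_subst_mem_weightIdeal {w : Fin 2 → ℕ} {e : ℕ}
    {a b : Fin 2 → MvPowerSeries (Fin 2) ℂ} (ha : HasSubst a) (hb : HasSubst b)
    {f g : MvPowerSeries (Fin 2) ℂ}
    (h : ∀ m, C (coeff m f) * (m.prod fun k n => a k ^ n) -
      C (coeff m g) * (m.prod fun k n => b k ^ n) ∈ weightIdeal w e) :
    subst a f - subst b g ∈ weightIdeal w e := by
  intro n hn
  by_contra hlt
  apply hn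
  rw [map_sub, coeff_subst ha, coeff_subst hb,
    ← finsum_sub_distrib (coeff_subst_finite ha f n) (coeff_subst_finite hb g n)]
  refine finsum_eq_zero_of_forall_eq_zero fun m => ?_
  have := coeff_eq_zero_of_mem_weightIdeal (h m) (not_le.mp hlt)
  simpa [coeff_C_mul] using this

theorem subst_mem_weightIdeal {w : Fin 2 → ℕ} {e : ℕ}
    {a : Fin 2 → MvPowerSeries (Fin 2) ℂ} (ha : HasSubst a) {f : MvPowerSeries (Fin 2) ℂ}
    (h : ∀ m, coeff m f ≠ 0 → (m.prod fun k n => a k ^ n) ∈ weightIdeal w e) :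
    subst a f ∈ weightIdeal w e := by
  have := subst_sub_subst_mem_weightIdeal (w := w) (e := e) ha ha (f := f) (g := 0) (fun m => by
    by_cases hm : coeff m f = 0
    · simp [hm]
    · simpa using C_mul_mem_weightIdeal _ (h m hm))
  rwa [← subst_sub ha, sub_zero] at this

/-- The source weight v and the target weight w may differ: the blow-up turns a facet weight v into
the order in a single variable. -/
theorem subst_mem_weightIdeal_of_weight {w v : Fin 2 → ℕ} {d : ℕ}
    {a : Fin 2 → MvPowerSeries (Fin 2) ℂ} (ha : HasSubst a) (hav : ∀ k, a k ∈ weightIdeal w (v k))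
    {f : MvPowerSeries (Fin 2) ℂ} (hf : f ∈ weightIdeal v d) : subst a f ∈ weightIdeal w d :=
  subst_mem_weightIdeal ha fun m hm => weightIdeal_anti (hf m hm) (prod_mem_weightIdeal hav m)

open Classical in
/-- The sum of the terms of weight `d` of a power series, for a positive weight. -/
noncomputable def weightedJet (w : Fin 2 → ℕ) (d : ℕ) (f : MvPowerSeries (Fin 2) ℂ) :
    MvPolynomial (Fin 2) ℂ :=
  ∑ᶠ m : Fin 2 →₀ ℕ, if Finsupp.weight w m = d then
    MvPolynomial.monomial m (coeff m f) else 0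

/-- Positivity of both weights bounds the degree. It makes the `finsum` in `weightedJet` a genuine
finite sum rather than the default value 0. -/
theorem finite_weight_eq {w : Fin 2 → ℕ} (hw : ∀ k, 0 < w k) (d : ℕ) :
    {m : Fin 2 →₀ ℕ | Finsupp.weight w m = d}.Finite := by
  refine (Finsupp.finite_of_degree_le (σ := Fin 2) d).subset fun m hm => ?_
  simp only [Set.mem_ofPred_eq] at hm ⊢
  rw [Finsupp.degree_eq_sum, Fin.sum_univ_two, ← hm, weight_fin_two w m zero_ne_one]
  have h0 := Nat.le_mul_of_pos_left (m 0) (hw 0)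
  have h1 := Nat.le_mul_of_pos_left (m 1) (hw 1)
  omega

theorem coeff_weightedJet {w : Fin 2 → ℕ} (hw : ∀ k, 0 < w k) (d : ℕ)
    (f : MvPowerSeries (Fin 2) ℂ) (n : Fin 2 →₀ ℕ) :
    MvPolynomial.coeff n (weightedJet w d f) = if Finsupp.weight w n = d then coeff n f else 0 := by
  classical
  rw [weightedJet, finsum_eq_sum_of_support_subset (s := (finite_weight_eq hw d).toFinset)]
  · rw [MvPolynomial.coeff_sum]
    split_ifs with h
    · rw [Finset.sum_eq_single n]
      · simp [h]
      · intro m hm hmn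
        split_ifs
        · rw [MvPolynomial.coeff_monomial, if_neg hmn]
        · simp
      · intro hn; simp [h] at hn
    · refine Finset.sum_eq_zero fun m hm => ?_
      have hm' : Finsupp.weight w m = d := by simpa using hm
      rw [if_pos hm', MvPolynomial.coeff_monomial, if_neg]
      rintro rfl; exact h hm'
  · intro m hm
    rw [Function.mem_support] at hm
    simpa using by_contra fun h => hm (if_neg h)

theorem isWeightedHomogeneous_weightedJet {w : Fin 2 → ℕ} (hw : ∀ k, 0 < w k) (d : ℕ)
    (f : MvPowerSeries (Fin 2) ℂ) : MvPolynomial.IsWeightedHomogeneous w (weightedJet w d f) d := by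
  intro m hm
  rw [coeff_weightedJet hw] at hm
  by_contra h
  exact hm (if_neg h)

/-- Substituting congruent series gives congruent results, up to terms of higher weight. -/
theorem subst_sub_subst_weightedJet_mem {w v : Fin 2 → ℕ} (hv : ∀ k, 0 < v k) {d : ℕ}
    {a b : Fin 2 → MvPowerSeries (Fin 2) ℂ} (ha : HasSubst a) (hb : HasSubst b)
    (haw : ∀ k, a k ∈ weightIdeal w (v k)) (hbw : ∀ k, b k ∈ weightIdeal w (v k))
    (hab : ∀ k, a k - b k ∈ weightIdeal w (v k + 1)) {f : MvPowerSeries (Fin 2) ℂ}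
    (hf : f ∈ weightIdeal v d) :
    subst a f - subst b (weightedJet v d f : MvPowerSeries (Fin 2) ℂ) ∈ weightIdeal w (d + 1) := by
  refine subst_sub_subst_mem_weightIdeal ha hb fun m => ?_
  rw [MvPolynomial.coeff_coe, coeff_weightedJet hv]
  -- Below d the coefficient of f vanishes, at d the two products are congruent, and above d the jet
  -- has no term while the product is already of weight greater than d.
  rcases lt_trichotomy (Finsupp.weight v m) d with h | h | h
  · simp [h.ne, coeff_eq_zero_of_mem_weightIdeal hf h]
  · rw [if_pos h, ← mul_sub, ← h]
    exact C_mul_mem_weightIdeal _ (prod_sub_prod_mem_weightIdeal haw hbw hab m)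
  · rw [if_neg h.ne', map_zero, zero_mul, sub_zero]
    exact C_mul_mem_weightIdeal _ (weightIdeal_anti h (prod_mem_weightIdeal haw m))

theorem weightedJet_eq_of_sub_mem {w : Fin 2 → ℕ} (hw : ∀ k, 0 < w k) {d : ℕ}
    {f g : MvPowerSeries (Fin 2) ℂ} (h : f - g ∈ weightIdeal w (d + 1)) :
    weightedJet w d f = weightedJet w d g := by
  ext n
  rw [coeff_weightedJet hw, coeff_weightedJet hw]
  split_ifs with hn
  · have := coeff_eq_zero_of_mem_weightIdeal h (m := n) (by omega)
    rwa [map_sub, sub_eq_zero] at this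
  · rfl

theorem weightedJet_coe {w : Fin 2 → ℕ} (hw : ∀ k, 0 < w k) {d : ℕ}
    {p : MvPolynomial (Fin 2) ℂ} (hp : MvPolynomial.IsWeightedHomogeneous w p d) :
    weightedJet w d (p : MvPowerSeries (Fin 2) ℂ) = p := by
  ext n
  rw [coeff_weightedJet hw, MvPolynomial.coeff_coe]
  split_ifs with hn
  · rfl
  · exact (hp.coeff_eq_zero n hn).symm

end ConvergentSeries

/-! ### Majorant norms and convergence of substitutions. -/

namespace ConvergentSeries

open MvPowerSeries
open scoped ENNReal NNReal

/-- The sum of the absolute values of the terms of a power series on a polycircle. -/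
noncomputable def polyNorm (ρ : Fin 2 → ℝ≥0∞) (f : MvPowerSeries (Fin 2) ℂ) : ℝ≥0∞ :=
  ∑' m : Fin 2 →₀ ℕ, ‖coeff m f‖ₑ * m.prod fun k n => ρ k ^ n

theorem prod_pow_add (ρ : Fin 2 → ℝ≥0∞) (m n : Fin 2 →₀ ℕ) :
    ((m + n).prod fun k n => ρ k ^ n) = (m.prod fun k n => ρ k ^ n) * n.prod fun k n => ρ k ^ n :=
  Finsupp.prod_add_index' (by simp) (by simp [pow_add])

theorem prod_const_pow (r : ℝ≥0∞) (m : Fin 2 →₀ ℕ) :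
    (m.prod fun _ n => r ^ n) = r ^ m.degree := by
  rw [prod_fin_two (fun _ => r) m zero_ne_one, Finsupp.degree_eq_sum, Fin.sum_univ_two, pow_add]

/-- Passing to sums in `ℝ≥0∞` makes every rearrangement and exchange of summation unconditional;
convergence becomes finiteness of a norm. -/
theorem isConvergent_iff_polyNorm {f : MvPowerSeries (Fin 2) ℂ} :
    IsConvergent f ↔ ∃ r : ℝ≥0, 0 < r ∧ polyNorm (fun _ => r) f ≠ ∞ := by
  have key : ∀ r : ℝ≥0, polyNorm (fun _ => r) f ≠ ∞ ↔
      Summable fun m : Fin 2 →₀ ℕ => ‖coeff m f‖ * (r : ℝ) ^ m.degree := by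
    intro r
    have h : polyNorm (fun _ => r) f =
        ∑' m : Fin 2 →₀ ℕ, ((‖coeff m f‖₊ * r ^ m.degree : ℝ≥0) : ℝ≥0∞) := by
      refine tsum_congr fun m => ?_
      rw [prod_const_pow]
      push_cast
      rfl
    rw [h, ENNReal.tsum_coe_ne_top_iff_summable, ← NNReal.summable_coe]
    simp
  constructor
  · rintro ⟨r, hr, h⟩
    exact ⟨⟨r, hr.le⟩, hr, (key _).mpr h⟩
  · rintro ⟨r, hr, h⟩
    exact ⟨r, hr, (key r).mp h⟩

theorem polyNorm_mono {ρ σ : Fin 2 → ℝ≥0∞} (h : ∀ k, ρ k ≤ σ k) (f : MvPowerSeries (Fin 2) ℂ) :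
    polyNorm ρ f ≤ polyNorm σ f := by
  refine ENNReal.tsum_le_tsum fun m => ?_
  rw [prod_fin_two ρ m zero_ne_one, prod_fin_two σ m zero_ne_one]
  have h0 := h 0
  have h1 := h 1
  gcongr

theorem polyNorm_mul_le (ρ : Fin 2 → ℝ≥0∞) (f g : MvPowerSeries (Fin 2) ℂ) :
    polyNorm ρ (f * g) ≤ polyNorm ρ f * polyNorm ρ g := by
  have h : polyNorm ρ f * polyNorm ρ g = ∑' p : (Fin 2 →₀ ℕ) × (Fin 2 →₀ ℕ),
      (‖coeff p.1 f‖ₑ * p.1.prod fun k n => ρ k ^ n) *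
        (‖coeff p.2 g‖ₑ * p.2.prod fun k n => ρ k ^ n) := by
    rw [ENNReal.tsum_prod', polyNorm, ← ENNReal.tsum_mul_right]
    exact tsum_congr fun m => ENNReal.tsum_mul_left.symm
  rw [h, ← (Finset.HasAntidiagonal.sigmaAntidiagonalEquivProd (A := Fin 2 →₀ ℕ)).tsum_eq, ENNReal.tsum_sigma']
  refine ENNReal.tsum_le_tsum fun m => ?_
  refine le_trans ?_ (Finset.tsum_subtype (Finset.HasAntidiagonal.antidiagonal m) fun p =>
    (‖coeff p.1 f‖ₑ * p.1.prod fun k n => ρ k ^ n) *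
      (‖coeff p.2 g‖ₑ * p.2.prod fun k n => ρ k ^ n)).ge
  rw [coeff_mul]
  refine (mul_le_mul_left (enorm_sum_le _ _) _).trans ?_
  rw [Finset.sum_mul]
  refine Finset.sum_le_sum fun p hp => le_of_eq ?_
  rw [Finset.HasAntidiagonal.mem_antidiagonal] at hp
  rw [enorm_mul, ← hp, prod_pow_add]
  ring

theorem polyNorm_monomial (ρ : Fin 2 → ℝ≥0∞) (m : Fin 2 →₀ ℕ) (c : ℂ) :
    polyNorm ρ (monomial m c) = ‖c‖ₑ * m.prod fun k n => ρ k ^ n := by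
  classical
  rw [polyNorm, tsum_eq_single m]
  · rw [coeff_monomial_same]
  · intro n hn
    rw [coeff_monomial_ne hn]
    simp

theorem polyNorm_one (ρ : Fin 2 → ℝ≥0∞) : polyNorm ρ 1 = 1 := by
  simpa using polyNorm_monomial ρ 0 1

theorem polyNorm_X (ρ : Fin 2 → ℝ≥0∞) (k : Fin 2) : polyNorm ρ (X k) = ρ k := by
  rw [X, polyNorm_monomial]
  simp

theorem polyNorm_pow_le (ρ : Fin 2 → ℝ≥0∞) (f : MvPowerSeries (Fin 2) ℂ) (n : ℕ) :
    polyNorm ρ (f ^ n) ≤ polyNorm ρ f ^ n := by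
  induction n with
  | zero => simp [polyNorm_one]
  | succ n ih =>
    rw [pow_succ, pow_succ]
    exact (polyNorm_mul_le _ _ _).trans (by gcongr)

theorem polyNorm_prod_le (ρ : Fin 2 → ℝ≥0∞) (a : Fin 2 → MvPowerSeries (Fin 2) ℂ)
    (m : Fin 2 →₀ ℕ) :
    polyNorm ρ (m.prod fun k n => a k ^ n) ≤ m.prod fun k n => polyNorm ρ (a k) ^ n := by
  rw [prod_fin_two a m zero_ne_one, prod_fin_two (fun k => polyNorm ρ (a k)) m zero_ne_one]
  exact (polyNorm_mul_le _ _ _).trans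
    (mul_le_mul' (polyNorm_pow_le _ _ _) (polyNorm_pow_le _ _ _))

/-- The majorant principle: expand f(a) term by term, exchange the two sums, and use
submultiplicativity. The norms of the a_k play the role of the radii at which f is evaluated. -/
theorem polyNorm_subst_le (ρ : Fin 2 → ℝ≥0∞) {a : Fin 2 → MvPowerSeries (Fin 2) ℂ}
    (ha : HasSubst a) (f : MvPowerSeries (Fin 2) ℂ) :
    polyNorm ρ (subst a f) ≤ polyNorm (fun k => polyNorm ρ (a k)) f := by
  have h1 : ∀ e, ‖coeff e (subst a f)‖ₑ ≤
      ∑' m, ‖coeff m f‖ₑ * ‖coeff e (m.prod fun k n => a k ^ n)‖ₑ := by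
    intro e
    rw [coeff_subst ha, finsum_eq_sum _ (coeff_subst_finite ha f e)]
    refine (enorm_sum_le _ _).trans ?_
    simp_rw [smul_eq_mul, enorm_mul]
    exact ENNReal.sum_le_tsum _
  calc polyNorm ρ (subst a f)
      ≤ ∑' e : Fin 2 →₀ ℕ, ∑' m, ‖coeff m f‖ₑ *
          (‖coeff e (m.prod fun k n => a k ^ n)‖ₑ * e.prod fun k n => ρ k ^ n) := by
        refine ENNReal.tsum_le_tsum fun e => (mul_le_mul_left (h1 e) _).trans (le_of_eq ?_)
        rw [← ENNReal.tsum_mul_right]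
        simp_rw [mul_assoc]
    _ = ∑' m, ‖coeff m f‖ₑ * polyNorm ρ (m.prod fun k n => a k ^ n) := by
        rw [ENNReal.tsum_comm]
        exact tsum_congr fun m => ENNReal.tsum_mul_left
    _ ≤ _ := ENNReal.tsum_le_tsum fun m => mul_le_mul_right (polyNorm_prod_le ρ a m) _

/-- Without constant term every monomial has degree at least 1, so shrinking the radius by t ≤ 1
gains at least one factor t. -/
theorem polyNorm_mul_radius_le {t : ℝ≥0∞} (ht : t ≤ 1) (r : ℝ≥0∞) {f : MvPowerSeries (Fin 2) ℂ}
    (hf : constantCoeff f = 0) :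
    polyNorm (fun _ => t * r) f ≤ t * polyNorm (fun _ => r) f := by
  rw [polyNorm, polyNorm, ← ENNReal.tsum_mul_left]
  refine ENNReal.tsum_le_tsum fun m => ?_
  rcases eq_or_ne m 0 with rfl | hm
  · rw [coeff_zero_eq_constantCoeff_apply, hf]
    simp
  · rw [prod_const_pow, prod_const_pow, mul_pow]
    have h : t ^ m.degree ≤ t := by
      have h1 : 1 ≤ m.degree := Nat.one_le_iff_ne_zero.mpr (by rwa [Ne, Finsupp.degree_eq_zero_iff])
      simpa using pow_le_pow_right_of_le_one' ht h1
    calc ‖coeff m f‖ₑ * (t ^ m.degree * r ^ m.degree)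
        ≤ ‖coeff m f‖ₑ * (t * r ^ m.degree) := by gcongr
      _ = _ := by ring

/-- A convergent power series without constant term is small on small polydiscs. -/
theorem exists_polyNorm_le {f : MvPowerSeries (Fin 2) ℂ} (hc : IsConvergent f)
    (hf : constantCoeff f = 0) {ε : ℝ≥0} (hε : 0 < ε) :
    ∃ s : ℝ≥0, 0 < s ∧ polyNorm (fun _ => s) f ≤ ε := by
  obtain ⟨r, hr, hN⟩ := isConvergent_iff_polyNorm.mp hc
  lift polyNorm (fun _ => r) f to ℝ≥0 using hN with M hM
  have hM1 : 0 < M + 1 := by positivity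
  -- The minimum keeps the scaling factor at most 1; dividing by M + 1 rather than M avoids the case
  -- M = 0.
  refine ⟨min 1 (ε / (M + 1)) * r, mul_pos (lt_min one_pos (div_pos hε hM1)) hr, ?_⟩
  have h1 := polyNorm_mul_radius_le (t := (min 1 (ε / (M + 1)) : ℝ≥0)) (by
    exact_mod_cast min_le_left _ _) r hf
  push_cast at h1 ⊢
  refine h1.trans ?_
  rw [← hM]
  have h2 : min 1 (ε / (M + 1)) * M ≤ ε := by
    calc min 1 (ε / (M + 1)) * M ≤ ε / (M + 1) * (M + 1) := by
          gcongr
          · exact min_le_right _ _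
          · exact le_self_add
      _ = ε := div_mul_cancel₀ _ hM1.ne'
  exact_mod_cast h2

/-- On a small polydisc each a_k has norm at most a radius r at which f has finite norm, and the
majorant principle applies. -/
theorem isConvergent_subst {a : Fin 2 → MvPowerSeries (Fin 2) ℂ}
    (ha : ∀ k, IsConvergent (a k)) (ha0 : ∀ k, constantCoeff (a k) = 0)
    {f : MvPowerSeries (Fin 2) ℂ} (hf : IsConvergent f) : IsConvergent (subst a f) := by
  obtain ⟨r, hr, hN⟩ := isConvergent_iff_polyNorm.mp hf
  choose s hs hsr using fun k => exists_polyNorm_le (ha k) (ha0 k) hr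
  refine isConvergent_iff_polyNorm.mpr ⟨min (s 0) (s 1), lt_min (hs 0) (hs 1), ?_⟩
  refine ((polyNorm_subst_le _ (hasSubst_of_constantCoeff_zero ha0) f).trans
    (polyNorm_mono (fun k => ?_) f)).trans_lt hN.lt_top |>.ne
  refine (polyNorm_mono (fun _ => ?_) (a k)).trans (hsr k)
  fin_cases k
  · exact_mod_cast min_le_left _ _
  · exact_mod_cast min_le_right _ _

/-- Substitution of germs vanishing at the origin as an endomorphism of `ℂ{x, y}`. -/
noncomputable def substHom (a : Fin 2 → ConvergentSeries)
    (ha : ∀ k, constantCoeff (a k : MvPowerSeries (Fin 2) ℂ) = 0) :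
    ConvergentSeries →ₐ[ℂ] ConvergentSeries :=
  ((substAlgHom (R := ℂ) (hasSubst_of_constantCoeff_zero ha)).comp ConvergentSeries.val).codRestrict
    ConvergentSeries fun f => by
      have h : IsConvergent (subst (fun k => (a k : MvPowerSeries (Fin 2) ℂ)) f.1) :=
        isConvergent_subst (fun k => (a k).2) ha f.2
      rw [← substAlgHom_apply (hasSubst_of_constantCoeff_zero ha)] at h
      exact h

theorem coe_substHom (a : Fin 2 → ConvergentSeries)
    (ha : ∀ k, constantCoeff (a k : MvPowerSeries (Fin 2) ℂ) = 0) (f : ConvergentSeries) :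
    (substHom a ha f : MvPowerSeries (Fin 2) ℂ) =
      subst (fun k => (a k : MvPowerSeries (Fin 2) ℂ)) (f : MvPowerSeries (Fin 2) ℂ) := by
  exact substAlgHom_apply (hasSubst_of_constantCoeff_zero ha) _

end ConvergentSeries

/-! ### The implicit function theorem by successive approximation. -/

namespace ConvergentSeries

open MvPowerSeries
open scoped ENNReal NNReal

theorem hasSubst_update_X {i : Fin 2} {v : MvPowerSeries (Fin 2) ℂ} (hv : constantCoeff v = 0) :
    HasSubst (Function.update (X : Fin 2 → MvPowerSeries (Fin 2) ℂ) i v) :=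
  hasSubst_of_constantCoeff_zero fun k => by
    rcases eq_or_ne k i with rfl | h
    · rwa [Function.update_self]
    · rw [Function.update_of_ne h, constantCoeff_X]

/-- Substitution into a series in one variable depends on the series for that variable only. -/
theorem subst_congr_of_forall_eq_zero {i j : Fin 2} (hij : i ≠ j)
    {a b : Fin 2 → MvPowerSeries (Fin 2) ℂ} (ha : HasSubst a) (hb : HasSubst b) (hab : a j = b j)
    {φ : MvPowerSeries (Fin 2) ℂ} (hφ : ∀ m, coeff m φ ≠ 0 → m i = 0) :
    subst a φ = subst b φ := by
  ext e
  rw [coeff_subst ha, coeff_subst hb]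
  refine finsum_congr fun m => ?_
  by_cases hm : coeff m φ = 0
  · simp [hm]
  · rw [prod_fin_two a m hij, prod_fin_two b m hij, hφ m hm, hab, pow_zero, pow_zero]

/-- With weight 1 on x_j and 0 on the other variable, the weight filtration is the x_j-adic one, so
the general filtration lemmas also serve for divisibility by powers of x_j. -/
theorem mem_weightIdeal_single_iff {j : Fin 2} {d : ℕ} {f : MvPowerSeries (Fin 2) ℂ} :
    f ∈ weightIdeal (Pi.single j 1) d ↔ ∀ m, coeff m f ≠ 0 → d ≤ m j := by
  have h : ∀ m : Fin 2 →₀ ℕ, Finsupp.weight (Pi.single j 1) m = m j := by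
    intro m
    rw [weight_fin_two _ m zero_ne_one]
    fin_cases j <;> simp
  simp [mem_weightIdeal, h]

theorem mem_weightIdeal_single_one {i j : Fin 2} (hij : i ≠ j) {φ : MvPowerSeries (Fin 2) ℂ}
    (hφ : ∀ m, coeff m φ ≠ 0 → m i = 0) (h0 : constantCoeff φ = 0) :
    φ ∈ weightIdeal (Pi.single j 1) 1 := by
  rw [mem_weightIdeal_single_iff]
  intro m hm
  by_contra h
  have : m = 0 := finsupp_ext_fin_two hij (hφ m hm) (by simpa using h)
  rw [this, coeff_zero_eq_constantCoeff_apply] at hm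
  exact hm h0

theorem eq_zero_of_forall_mem_weightIdeal {j : Fin 2} {f : MvPowerSeries (Fin 2) ℂ}
    (h : ∀ n, f ∈ weightIdeal (Pi.single j 1) n) : f = 0 := by
  ext m
  by_contra hm
  have := mem_weightIdeal_single_iff.mp (h (m j + 1)) m hm
  omega

/-- The implicit equation `u = H(u, y)` is contracting if `H` has neither a constant term nor a
term linear in `u`. -/
theorem subst_update_sub_subst_update_mem {i j : Fin 2} (hij : i ≠ j)
    {H v v' : MvPowerSeries (Fin 2) ℂ} (hH : coeff (Finsupp.single i 1) H = 0) {n : ℕ}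
    (hv0 : constantCoeff v = 0) (hv0' : constantCoeff v' = 0)
    (hv : v ∈ weightIdeal (Pi.single j 1) 1) (hv' : v' ∈ weightIdeal (Pi.single j 1) 1)
    (hvv : v - v' ∈ weightIdeal (Pi.single j 1) n) :
    subst (Function.update X i v) H - subst (Function.update X i v') H ∈
      weightIdeal (Pi.single j 1) (n + 1) := by
  refine subst_sub_subst_mem_weightIdeal (hasSubst_update_X hv0) (hasSubst_update_X hv0')
    fun m => ?_
  rw [← mul_sub]
  by_cases hm : coeff m H = 0
  · simp [hm]
  refine C_mul_mem_weightIdeal _ ?_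
  rw [prod_fin_two _ m hij, prod_fin_two _ m hij, Function.update_self, Function.update_self,
    Function.update_of_ne hij.symm, Function.update_of_ne hij.symm, ← sub_mul]
  have hpow : ∀ a, v ^ a - v' ^ a ∈ weightIdeal (Pi.single j 1) n := fun a =>
    Ideal.mem_of_dvd _ (sub_dvd_pow_sub_pow v v' a) hvv
  -- A factor x_j supplies the extra order. Without it, the constant term cancels, the term linear
  -- in x_i is excluded by `hH`, and for exponents at least 2 the difference of powers splits into
  -- differences of order n times v or v', both of order at least 1.
  rcases Nat.eq_zero_or_pos (m j) with hj | hj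
  · rw [hj, pow_zero, mul_one]
    obtain ha | ha | ⟨a, ha⟩ : m i = 0 ∨ m i = 1 ∨ ∃ a, m i = a + 2 := by
      rcases h : m i with _ | _ | a
      · simp
      · simp
      · exact .inr (.inr ⟨a, rfl⟩)
    · simp [ha]
    · refine absurd hH ?_
      rwa [← show m = Finsupp.single i 1 from
        finsupp_ext_fin_two hij (by simp [ha]) (by simp [hj, hij])]
    · have h : v ^ m i - v' ^ m i = (v ^ (a + 1) - v' ^ (a + 1)) * v + (v - v') * v' * v' ^ a := by
        rw [ha]; ring
      rw [h]
      exact add_mem (mul_mem_weightIdeal (hpow _) hv)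
        (Ideal.mul_mem_right _ _ (mul_mem_weightIdeal hvv hv'))
  · refine mul_mem_weightIdeal (hpow _) ?_
    have h := pow_mem_weightIdeal (X_mem_weightIdeal (Pi.single j 1) j) (m j)
    rw [Pi.single_eq_same, mul_one] at h
    exact weightIdeal_anti hj h

/-- The successive approximations of the solution of `u = H(u, y)`. -/
noncomputable def implicitIterate (i : Fin 2) (H : MvPowerSeries (Fin 2) ℂ) :
    ℕ → MvPowerSeries (Fin 2) ℂ
  | 0 => 0
  | n + 1 => subst (Function.update X i (implicitIterate i H n)) H

/-- The formal solution of `u = H(u, y)`. -/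
noncomputable def implicitLimit (i j : Fin 2) (H : MvPowerSeries (Fin 2) ℂ) :
    MvPowerSeries (Fin 2) ℂ := fun m => coeff m (implicitIterate i H (m j + 1))

theorem coeff_implicitLimit (i j : Fin 2) (H : MvPowerSeries (Fin 2) ℂ) (m : Fin 2 →₀ ℕ) :
    coeff m (implicitLimit i j H) = coeff m (implicitIterate i H (m j + 1)) := by
  rw [coeff_apply, implicitLimit]

section implicit

variable {i j : Fin 2} {H : MvPowerSeries (Fin 2) ℂ}

theorem constantCoeff_implicitIterate (hH0 : constantCoeff H = 0) (n : ℕ) :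
    constantCoeff (implicitIterate i H n) = 0 := by
  induction n with
  | zero => simp [implicitIterate]
  | succ n ih =>
    refine constantCoeff_subst_eq_zero (hasSubst_update_X ih) (fun k => ?_) hH0
    rcases eq_or_ne k i with rfl | h
    · rwa [Function.update_self]
    · rw [Function.update_of_ne h, constantCoeff_X]

theorem coeff_implicitIterate_ne_zero (hij : i ≠ j) (hH0 : constantCoeff H = 0) (n : ℕ) :
    ∀ m, coeff m (implicitIterate i H n) ≠ 0 → m i = 0 := by
  induction n with
  | zero => simp [implicitIterate]
  | succ n ih =>
    have h0 := constantCoeff_implicitIterate (i := i) hH0 n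
    have hs := hasSubst_update_X (i := i) h0
    have hz := hasSubst_update_X (i := i) (v := 0) (map_zero _)
    -- Setting x_i = 0 fixes the previous iterate, by induction, and fixes x_j. Hence it fixes the
    -- next iterate, which therefore cannot involve x_i.
    have h : subst (Function.update X i 0) (implicitIterate i H (n + 1)) =
        implicitIterate i H (n + 1) := by
      rw [implicitIterate, subst_comp_subst_apply hs hz]
      congr 1
      funext k
      rcases eq_or_ne k i with rfl | hk
      · rw [Function.update_self, subst_congr_of_forall_eq_zero hij hz HasSubst.X
          (Function.update_of_ne hij.symm _ _) ih, subst_self, id]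
      · rw [Function.update_of_ne hk, subst_X hz, Function.update_of_ne hk]
    intro m hm
    rw [← h, coeff_subst hz] at hm
    by_contra hmi
    refine hm (finsum_eq_zero_of_forall_eq_zero fun p => ?_)
    rw [prod_fin_two _ p hij, Function.update_self, Function.update_of_ne hij.symm]
    rcases Nat.eq_zero_or_pos (p i) with hp | hp
    · rw [hp, pow_zero, one_mul, X_pow_eq, coeff_monomial_ne, smul_zero]
      rintro rfl
      simp [hij.symm] at hmi
    · rw [zero_pow hp.ne', zero_mul, map_zero, smul_zero]

theorem implicitIterate_mem (hij : i ≠ j) (hH0 : constantCoeff H = 0) (n : ℕ) :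
    implicitIterate i H n ∈ weightIdeal (Pi.single j 1) 1 :=
  mem_weightIdeal_single_one hij (coeff_implicitIterate_ne_zero hij hH0 n)
    (constantCoeff_implicitIterate hH0 n)

/-- Each application of the contraction gains one order in x_j, so the iterates form a Cauchy
sequence for the x_j-adic filtration. -/
theorem implicitIterate_sub_mem (hij : i ≠ j) (hH0 : constantCoeff H = 0)
    (hH1 : coeff (Finsupp.single i 1) H = 0) (n k : ℕ) :
    implicitIterate i H (n + k) - implicitIterate i H n ∈ weightIdeal (Pi.single j 1) n := by
  induction n with
  | zero => exact mem_weightIdeal_zero _ _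
  | succ n ih =>
    rw [Nat.succ_add]
    exact subst_update_sub_subst_update_mem hij hH1 (constantCoeff_implicitIterate hH0 _)
      (constantCoeff_implicitIterate hH0 _) (implicitIterate_mem hij hH0 _)
      (implicitIterate_mem hij hH0 _) ih

/-- The coefficient at m is stable from the iterate with index m j + 1 on, which is why the limit is
read off there. -/
theorem coeff_implicitLimit_eq (hij : i ≠ j) (hH0 : constantCoeff H = 0)
    (hH1 : coeff (Finsupp.single i 1) H = 0) {n : ℕ} {m : Fin 2 →₀ ℕ} (h : m j < n) :
    coeff m (implicitLimit i j H) = coeff m (implicitIterate i H n) := by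
  obtain ⟨k, rfl⟩ := Nat.exists_eq_add_of_le (Nat.succ_le_of_lt h)
  rw [coeff_implicitLimit]
  by_contra hne
  have := mem_weightIdeal_single_iff.mp (implicitIterate_sub_mem hij hH0 hH1 (m j + 1) k) m
    (by rw [map_sub]; exact sub_ne_zero.mpr (Ne.symm hne))
  omega

theorem implicitLimit_sub_mem (hij : i ≠ j) (hH0 : constantCoeff H = 0)
    (hH1 : coeff (Finsupp.single i 1) H = 0) (n : ℕ) :
    implicitLimit i j H - implicitIterate i H n ∈ weightIdeal (Pi.single j 1) n := by
  rw [mem_weightIdeal_single_iff]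
  intro m hm
  by_contra h
  exact hm (by rw [map_sub, coeff_implicitLimit_eq hij hH0 hH1 (not_le.mp h), sub_self])

theorem coeff_implicitLimit_ne_zero (hij : i ≠ j) (hH0 : constantCoeff H = 0) :
    ∀ m, coeff m (implicitLimit i j H) ≠ 0 → m i = 0 := fun m hm =>
  coeff_implicitIterate_ne_zero hij hH0 (m j + 1) m (by rwa [coeff_implicitLimit] at hm)

theorem constantCoeff_implicitLimit (hH0 : constantCoeff H = 0) :
    constantCoeff (implicitLimit i j H) = 0 := by
  rw [← coeff_zero_eq_constantCoeff_apply, coeff_implicitLimit, coeff_zero_eq_constantCoeff_apply,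
    constantCoeff_implicitIterate hH0]

/-- The limit and the n-th iterate agree to order n; applying the contraction raises this to n + 1,
where the limit is also compared with the next iterate. The two sides thus agree to every order. -/
theorem subst_implicitLimit (hij : i ≠ j) (hH0 : constantCoeff H = 0)
    (hH1 : coeff (Finsupp.single i 1) H = 0) :
    subst (Function.update X i (implicitLimit i j H)) H = implicitLimit i j H := by
  rw [← sub_eq_zero]
  refine eq_zero_of_forall_mem_weightIdeal (j := j) fun n => ?_
  have h1 := subst_update_sub_subst_update_mem hij hH1 (constantCoeff_implicitLimit hH0)
    (constantCoeff_implicitIterate hH0 n)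
    (mem_weightIdeal_single_one hij (coeff_implicitLimit_ne_zero hij hH0)
      (constantCoeff_implicitLimit hH0)) (implicitIterate_mem hij hH0 n)
    (implicitLimit_sub_mem hij hH0 hH1 n)
  have h2 := implicitLimit_sub_mem hij hH0 hH1 (n + 1)
  have h3 := sub_mem h1 h2
  rw [implicitIterate, sub_sub_sub_cancel_right] at h3
  exact weightIdeal_anti n.le_succ h3

/-- The sizes are weighted: u is kept of size tρ while x_j has size t²ρ. A monomial of H then scales
by t to the power m_i + 2 m_j, which is at least 2 because H has neither a constant term nor a term
linear in x_i. One factor t is absorbed by `hM`, and the bound tρ reproduces itself. -/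
theorem polyNorm_implicitIterate_le (hij : i ≠ j) (hH0 : constantCoeff H = 0)
    (hH1 : coeff (Finsupp.single i 1) H = 0) {ρ t : ℝ≥0∞} (ht : t ≤ 1)
    (hM : t * polyNorm (fun _ => ρ) H ≤ ρ) (n : ℕ) :
    polyNorm (fun _ => t ^ 2 * ρ) (implicitIterate i H n) ≤ t * ρ := by
  induction n with
  | zero => simp [implicitIterate, polyNorm]
  | succ n ih =>
    refine (polyNorm_subst_le _
      (hasSubst_update_X (constantCoeff_implicitIterate hH0 n)) H).trans ?_
    refine le_trans ?_ (mul_le_mul_right hM t)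
    rw [← mul_assoc, polyNorm, polyNorm, ← ENNReal.tsum_mul_left]
    refine ENNReal.tsum_le_tsum fun m => ?_
    by_cases hm : coeff m H = 0
    · simp [hm]
    have h2 : 2 ≤ m i + 2 * m j := by
      by_contra hlt
      have hj : m j = 0 := by omega
      have hi : m i = 0 ∨ m i = 1 := by omega
      rcases hi with hi | hi
      · rw [show m = 0 from finsupp_ext_fin_two hij hi hj, coeff_zero_eq_constantCoeff_apply] at hm
        exact hm hH0
      · rw [show m = Finsupp.single i 1 from
          finsupp_ext_fin_two hij (by simp [hi]) (by simp [hj, hij])] at hm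
        exact hm hH1
    rw [prod_fin_two _ m hij, prod_fin_two _ m hij, Function.update_self,
      Function.update_of_ne hij.symm, polyNorm_X]
    calc ‖coeff m H‖ₑ * (polyNorm (fun _ => t ^ 2 * ρ) (implicitIterate i H n) ^ m i *
          (t ^ 2 * ρ) ^ m j)
        ≤ ‖coeff m H‖ₑ * ((t * ρ) ^ m i * (t ^ 2 * ρ) ^ m j) := by gcongr
      _ = t ^ (m i + 2 * m j) * (‖coeff m H‖ₑ * (ρ ^ m i * ρ ^ m j)) := by ring
      _ ≤ t ^ 2 * (‖coeff m H‖ₑ * (ρ ^ m i * ρ ^ m j)) := by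
          gcongr ?_ * _
          exact pow_le_pow_right_of_le_one' ht h2
      _ = _ := by ring

theorem isConvergent_implicitLimit (hij : i ≠ j) (hH0 : constantCoeff H = 0)
    (hH1 : coeff (Finsupp.single i 1) H = 0) (hc : IsConvergent H) :
    IsConvergent (implicitLimit i j H) := by
  obtain ⟨ρ, hρ, hN⟩ := isConvergent_iff_polyNorm.mp hc
  obtain ⟨t, ht0, ht1, htM⟩ : ∃ t : ℝ≥0, 0 < t ∧ t ≤ 1 ∧
      (t : ℝ≥0∞) * polyNorm (fun _ => ρ) H ≤ ρ := by
    lift polyNorm (fun _ => ρ) H to ℝ≥0 using hN with M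
    have hM1 : 0 < M + 1 := by positivity
    refine ⟨min 1 (ρ / (M + 1)), lt_min one_pos (div_pos hρ hM1), min_le_left _ _, ?_⟩
    have h2 : min 1 (ρ / (M + 1)) * M ≤ ρ := by
      calc min 1 (ρ / (M + 1)) * M ≤ ρ / (M + 1) * (M + 1) := by
            gcongr
            · exact min_le_right _ _
            · exact le_self_add
        _ = ρ := div_mul_cancel₀ _ hM1.ne'
    exact_mod_cast h2
  refine isConvergent_iff_polyNorm.mpr ⟨t ^ 2 * ρ, by positivity, ?_⟩
  refine ne_top_of_le_ne_top (b := (t : ℝ≥0∞) * ρ) (by finiteness) ?_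
  rw [polyNorm, ENNReal.tsum_eq_iSup_sum]
  refine iSup_le fun S => ?_
  -- A finite partial sum sees only finitely many exponents, so it coincides with that of a single
  -- late iterate, whose norm is bounded independently of the index.
  refine le_trans ?_ (polyNorm_implicitIterate_le hij hH0 hH1 (by exact_mod_cast ht1) htM
    (S.sup (fun m => m j) + 1))
  refine le_trans (le_of_eq ?_) (ENNReal.sum_le_tsum S)
  refine Finset.sum_congr rfl fun m hm => ?_
  rw [coeff_implicitLimit_eq hij hH0 hH1
    (Nat.lt_succ_of_le (Finset.le_sup (f := fun m : Fin 2 →₀ ℕ => m j) hm))]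
  push_cast
  rfl

end implicit

/-- The implicit function theorem for convergent power series in two variables. -/
theorem exists_subst_update_eq_zero {i j : Fin 2} (hij : i ≠ j) {G : MvPowerSeries (Fin 2) ℂ}
    (hG : IsConvergent G) (h0 : constantCoeff G = 0) (h1 : coeff (Finsupp.single i 1) G ≠ 0) :
    ∃ u : MvPowerSeries (Fin 2) ℂ, IsConvergent u ∧ constantCoeff u = 0 ∧
      (∀ m, coeff m u ≠ 0 → m i = 0) ∧ subst (Function.update X i u) G = 0 := by
  set c := (coeff (Finsupp.single i 1) G)⁻¹ with hc
  have hc0 : c ≠ 0 := inv_ne_zero h1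
  -- Dividing G by its coefficient at x_i makes u = H(u, x_j) equivalent to G(u, x_j) = 0 and
  -- cancels the term linear in x_i.
  set H : MvPowerSeries (Fin 2) ℂ := X i - C c * G with hH
  have hH0 : constantCoeff H = 0 := by simp [hH, h0]
  have hH1 : coeff (Finsupp.single i 1) H = 0 := by
    classical
    rw [hH, map_sub, coeff_C_mul, hc, inv_mul_cancel₀ h1, coeff_X, if_pos rfl, sub_self]
  have hHc : IsConvergent H := by
    have hX : (X i : MvPowerSeries (Fin 2) ℂ) ∈ ConvergentSeries := by
      rw [← MvPolynomial.coe_X]; exact isConvergent_coe _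
    have hC : (C c : MvPowerSeries (Fin 2) ℂ) ∈ ConvergentSeries :=
      ConvergentSeries.algebraMap_mem c
    exact sub_mem hX (mul_mem hC hG)
  have hu0 := constantCoeff_implicitLimit (i := i) (j := j) hH0
  refine ⟨implicitLimit i j H, isConvergent_implicitLimit hij hH0 hH1 hHc, hu0,
    coeff_implicitLimit_ne_zero hij hH0, ?_⟩
  have h := subst_implicitLimit hij hH0 hH1
  have hs := hasSubst_update_X (i := i) hu0
  generalize implicitLimit i j H = u at *
  rw [hH, subst_sub hs, subst_mul hs, subst_C, subst_X hs, Function.update_self, sub_eq_self] at h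
  exact (mul_eq_zero.mp h).resolve_left (by simpa using hc0)

end ConvergentSeries

/-! ### Shears and Milnor numbers of weighted homogeneous polynomials. -/

namespace ConvergentSeries

open MvPowerSeries

/-- The polynomials as a subalgebra of the ring of germs. -/
noncomputable def ofPolyHom : MvPolynomial (Fin 2) ℂ →ₐ[ℂ] ConvergentSeries :=
  (MvPolynomial.coeToMvPowerSeries.algHom ℂ).codRestrict ConvergentSeries fun p => by
    have h := isConvergent_coe p
    simpa using! h

theorem ofPolyHom_apply (p : MvPolynomial (Fin 2) ℂ) : ofPolyHom p = ofPoly p :=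
  Subtype.ext (by simp [ofPolyHom, ofPoly])

theorem coe_ofPoly (p : MvPolynomial (Fin 2) ℂ) :
    (ofPoly p : MvPowerSeries (Fin 2) ℂ) = (p : MvPowerSeries (Fin 2) ℂ) := rfl

theorem partialDeriv_ofPoly (k : Fin 2) (p : MvPolynomial (Fin 2) ℂ) :
    partialDeriv k (ofPoly p) = ofPoly (MvPolynomial.pderiv k p) :=
  Subtype.ext (pderiv_coe p)

/-- The chain rule for polynomials. -/
theorem pderiv_aeval (s : Fin 2 → MvPolynomial (Fin 2) ℂ) (i : Fin 2)
    (p : MvPolynomial (Fin 2) ℂ) :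
    MvPolynomial.pderiv i (MvPolynomial.aeval s p) =
      ∑ k, MvPolynomial.aeval s (MvPolynomial.pderiv k p) * MvPolynomial.pderiv i (s k) := by
  induction p using MvPolynomial.induction_on with
  | C c => simp
  | add p q hp hq => simp only [map_add, hp, hq, add_mul, Finset.sum_add_distrib]
  | mul_X p n hp =>
    simp only [map_mul, Derivation.leibniz, hp, MvPolynomial.aeval_X, smul_eq_mul, map_add,
      MvPolynomial.pderiv_X, add_mul, Finset.sum_add_distrib, Fin.sum_univ_two]
    fin_cases n <;> simp <;> ring

/-- The truncated subtraction is harmless: for n < w k no monomial of p contains the variable k, so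
the derivative is zero. -/
theorem isWeightedHomogeneous_pderiv {w : Fin 2 → ℕ} {p : MvPolynomial (Fin 2) ℂ} {n : ℕ}
    (hp : MvPolynomial.IsWeightedHomogeneous w p n) (k : Fin 2) :
    MvPolynomial.IsWeightedHomogeneous w (MvPolynomial.pderiv k p) (n - w k) := by
  intro m hm
  rw [← MvPolynomial.coeff_coe, ← pderiv_coe, coeff_pderiv, MvPolynomial.coeff_coe] at hm
  have h := hp (left_ne_zero_of_mul hm)
  rw [map_add, Finsupp.weight_single, one_smul] at h
  omega

/-- Serves both for restricting derivatives to a weighted orbit and for extracting the exceptional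
factor in the blow-up. -/
theorem aeval_pow_mul_of_isWeightedHomogeneous {A : Type*} [CommRing A] [Algebra ℂ A]
    {w : Fin 2 → ℕ} {p : MvPolynomial (Fin 2) ℂ} {n : ℕ}
    (hp : MvPolynomial.IsWeightedHomogeneous w p n) (s : Fin 2 → A) (t : A) :
    MvPolynomial.aeval (fun k => t ^ w k * s k) p = t ^ n * MvPolynomial.aeval s p := by
  rw [MvPolynomial.aeval_def, MvPolynomial.aeval_def, MvPolynomial.eval₂_eq',
    MvPolynomial.eval₂_eq', Finset.mul_sum]
  refine Finset.sum_congr rfl fun m hm => ?_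
  have h := hp (MvPolynomial.mem_support_iff.mp hm)
  rw [weight_fin_two w m zero_ne_one] at h
  rw [Fin.prod_univ_two, Fin.prod_univ_two, ← h]
  ring

theorem coe_aeval (s : Fin 2 → MvPolynomial (Fin 2) ℂ) (p : MvPolynomial (Fin 2) ℂ) :
    (MvPolynomial.aeval s p : MvPowerSeries (Fin 2) ℂ) =
      MvPolynomial.aeval (fun k => (s k : MvPowerSeries (Fin 2) ℂ)) p := by
  have h : ((MvPolynomial.coeToMvPowerSeries.algHom ℂ).comp
      (MvPolynomial.aeval s) : MvPolynomial (Fin 2) ℂ →ₐ[ℂ] _) =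
      MvPolynomial.aeval (fun k => (s k : MvPowerSeries (Fin 2) ℂ)) := by
    refine MvPolynomial.algHom_ext fun k => ?_
    rw [AlgHom.comp_apply, MvPolynomial.aeval_X, MvPolynomial.aeval_X]
    simp
  rw [← h]
  simp

/-- A weighted homogeneous polynomial with finite Milnor number at the origin has no other critical
points. -/
theorem exists_eval_pderiv_ne_zero {w : Fin 2 → ℕ} (hw : ∀ k, 0 < w k)
    {p : MvPolynomial (Fin 2) ℂ} {n : ℕ} (hp : MvPolynomial.IsWeightedHomogeneous w p n)
    (hM : HasFiniteMilnorNumber (ofPoly p)) {P : Fin 2 → ℂ} {j : Fin 2} (hP : P j ≠ 0) :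
    ∃ k, MvPolynomial.eval P (MvPolynomial.pderiv k p) ≠ 0 := by
  by_contra! hcrit
  -- The weighted orbit of P, as a parametrized curve with parameter t = `X 0`. If P is critical,
  -- all derivatives of p vanish along it, so pullback to the curve factors through the Milnor
  -- algebra.
  set a : Fin 2 → MvPowerSeries (Fin 2) ℂ := fun k => X 0 ^ w k * C (P k) with ha
  have ha0 : ∀ k, constantCoeff (a k) = 0 := fun k => by simp [ha, (hw k).ne']
  have hs : HasSubst a := hasSubst_of_constantCoeff_zero ha0
  let e : ConvergentSeries →ₐ[ℂ] MvPowerSeries (Fin 2) ℂ :=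
    (substAlgHom (R := ℂ) hs).comp ConvergentSeries.val
  have he : ∀ q : MvPolynomial (Fin 2) ℂ, e (ofPoly q) = MvPolynomial.aeval a q := fun q =>
    substAlgHom_coe hs q
  have hJ : ∀ f : ConvergentSeries, f ∈ jacobianIdeal (ofPoly p) → e f = 0 := by
    have h : jacobianIdeal (ofPoly p) ≤ RingHom.ker e := by
      rw [jacobianIdeal, Ideal.span_le]
      rintro _ ⟨k, rfl⟩
      rw [SetLike.mem_coe, RingHom.mem_ker]
      beta_reduce
      have hC : (fun k => C (P k) : Fin 2 → MvPowerSeries (Fin 2) ℂ) =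
        algebraMap ℂ _ ∘ P := rfl
      rw [partialDeriv_ofPoly, he, ha,
        aeval_pow_mul_of_isWeightedHomogeneous (isWeightedHomogeneous_pderiv hp k)
          (fun k => C (P k)) (X 0), hC, MvPolynomial.aeval_algebraMap_apply,
        MvPolynomial.aeval_eq_eval, hcrit, map_zero, mul_zero]
    exact fun f hf => h hf
  let l := Ideal.Quotient.liftₐ _ e hJ
  have : Module.Finite ℂ (ConvergentSeries ⧸ jacobianIdeal (ofPoly p)) := hM
  have : Module.Finite ℂ l.range :=
    Module.Finite.of_surjective l.rangeRestrict.toLinearMap l.rangeRestrict_surjective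
  have : IsDomain (MvPowerSeries (Fin 2) ℂ) := NoZeroDivisors.to_isDomain _
  have hmem : a j ∈ l.range :=
    ⟨Ideal.Quotient.mk _ (ofPoly (MvPolynomial.X j)), by
      have : l (Ideal.Quotient.mk _ (ofPoly (MvPolynomial.X j))) =
        e (ofPoly (MvPolynomial.X j)) := rfl
      rw [AlgHom.toRingHom_eq_coe, RingHom.coe_coe, this, he, MvPolynomial.aeval_X]⟩
  -- The image of the Milnor algebra is a finite-dimensional domain over ℂ, hence ℂ itself, yet it
  -- contains the non-constant element t ^ w_j P_j.
  obtain ⟨c, hc⟩ := (IsAlgClosed.algebraMap_bijective_of_isIntegral (k := ℂ) (K := l.range)).2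
    ⟨a j, hmem⟩
  have hc' : C c = a j := congrArg Subtype.val hc
  have hc0 : c = 0 := by
    have := congrArg constantCoeff hc'
    rwa [constantCoeff_C, ha0] at this
  rw [hc0, map_zero] at hc'
  refine mul_ne_zero (pow_ne_zero _ ?_) ?_ hc'.symm
  swap
  · simpa using hP
  · intro h
    have h1 := congrArg (coeff (Finsupp.single (0 : Fin 2) 1)) h
    rw [coeff_index_single_self_X, map_zero] at h1
    exact one_ne_zero h1

/-- The polynomial shear `x ↦ x + c y ^ α`. -/
noncomputable def polyShear (i j : Fin 2) (c : ℂ) (α : ℕ) : Fin 2 → MvPolynomial (Fin 2) ℂ :=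
  Function.update MvPolynomial.X i (MvPolynomial.X i + MvPolynomial.C c * MvPolynomial.X j ^ α)

/-- The shear `x ↦ x + φ`. -/
noncomputable def shearVec (i : Fin 2) (φ : MvPowerSeries (Fin 2) ℂ) :
    Fin 2 → MvPowerSeries (Fin 2) ℂ := Function.update X i (X i + φ)

theorem shearVec_self (i : Fin 2) (φ : MvPowerSeries (Fin 2) ℂ) :
    shearVec i φ i = X i + φ := Function.update_self ..

theorem shearVec_of_ne {i k : Fin 2} (h : k ≠ i) (φ : MvPowerSeries (Fin 2) ℂ) :
    shearVec i φ k = X k := Function.update_of_ne h ..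

theorem constantCoeff_shearVec {i : Fin 2} {φ : MvPowerSeries (Fin 2) ℂ}
    (hφ : constantCoeff φ = 0) (k : Fin 2) : constantCoeff (shearVec i φ k) = 0 := by
  rcases eq_or_ne k i with rfl | h
  · simp [shearVec_self, hφ]
  · simp [shearVec_of_ne h]

theorem hasSubst_shearVec {i : Fin 2} {φ : MvPowerSeries (Fin 2) ℂ}
    (hφ : constantCoeff φ = 0) : HasSubst (shearVec i φ) :=
  hasSubst_of_constantCoeff_zero (constantCoeff_shearVec hφ)

theorem isConvergent_X (k : Fin 2) : IsConvergent (X k) := by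
  rw [← MvPolynomial.coe_X]; exact isConvergent_coe _

theorem isConvergent_shearVec {i : Fin 2} {φ : MvPowerSeries (Fin 2) ℂ}
    (hφ : IsConvergent φ) (k : Fin 2) : IsConvergent (shearVec i φ k) := by
  rcases eq_or_ne k i with rfl | h
  · rw [shearVec_self]; exact isConvergent_add (isConvergent_X _) hφ
  · rw [shearVec_of_ne h]; exact isConvergent_X _

/-- Since φ does not involve x_i, the second shear leaves it unchanged, and the two translations add
up to zero. -/
theorem subst_shearVec_subst_shearVec {i j : Fin 2} (hij : i ≠ j) {φ ψ : MvPowerSeries (Fin 2) ℂ}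
    (hφ0 : constantCoeff φ = 0) (hψ0 : constantCoeff ψ = 0)
    (hφ : ∀ m, coeff m φ ≠ 0 → m i = 0) (h : φ + ψ = 0) (f : MvPowerSeries (Fin 2) ℂ) :
    subst (shearVec i ψ) (subst (shearVec i φ) f) = f := by
  have h1 := hasSubst_shearVec (i := i) hφ0
  have h2 := hasSubst_shearVec (i := i) hψ0
  rw [subst_comp_subst_apply h1 h2]
  have : (fun s => subst (shearVec i ψ) (shearVec i φ s)) = X := by
    funext k
    rcases eq_or_ne k i with rfl | hk
    · rw [shearVec_self, subst_add h2, subst_X h2, shearVec_self,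
        subst_congr_of_forall_eq_zero hij h2 HasSubst.X (shearVec_of_ne hij.symm _) hφ, subst_self,
        id, add_assoc, add_comm ψ, h, add_zero]
    · rw [shearVec_of_ne hk, subst_X h2, shearVec_of_ne hk]
  rw [this, subst_self, id]

/-- The shear `x ↦ x + φ(y)` as an automorphism of the ring of germs. -/
noncomputable def shearEquiv {i j : Fin 2} (hij : i ≠ j) (φ : ConvergentSeries)
    (hφ0 : constantCoeff (φ : MvPowerSeries (Fin 2) ℂ) = 0)
    (hφ : ∀ m, coeff m (φ : MvPowerSeries (Fin 2) ℂ) ≠ 0 → m i = 0) :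
    ConvergentSeries ≃ₐ[ℂ] ConvergentSeries :=
  have hneg0 : constantCoeff (-φ : MvPowerSeries (Fin 2) ℂ) = 0 := by rw [map_neg, hφ0, neg_zero]
  have hneg : ∀ m, coeff m (-φ : MvPowerSeries (Fin 2) ℂ) ≠ 0 → m i = 0 := fun m hm =>
    hφ m (by simpa using hm)
  AlgEquiv.ofAlgHom
    (substHom (fun k => ⟨shearVec i φ k, isConvergent_shearVec φ.2 k⟩)
      (constantCoeff_shearVec hφ0))
    (substHom (fun k => ⟨shearVec i (-φ) k, isConvergent_shearVec (neg_mem φ.2) k⟩)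
      (constantCoeff_shearVec hneg0))
    (AlgHom.ext fun f => Subtype.ext (by
      rw [AlgHom.comp_apply, coe_substHom, coe_substHom]
      exact subst_shearVec_subst_shearVec hij hneg0 hφ0 hneg (neg_add_cancel _) _))
    (AlgHom.ext fun f => Subtype.ext (by
      rw [AlgHom.comp_apply, coe_substHom, coe_substHom]
      exact subst_shearVec_subst_shearVec hij hφ0 hneg0 hφ (add_neg_cancel _) _))

theorem coe_shearEquiv {i j : Fin 2} (hij : i ≠ j) (φ : ConvergentSeries)
    (hφ0 : constantCoeff (φ : MvPowerSeries (Fin 2) ℂ) = 0)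
    (hφ : ∀ m, coeff m (φ : MvPowerSeries (Fin 2) ℂ) ≠ 0 → m i = 0) (f : ConvergentSeries) :
    (shearEquiv hij φ hφ0 hφ f : MvPowerSeries (Fin 2) ℂ) =
      subst (shearVec i (φ : MvPowerSeries (Fin 2) ℂ)) (f : MvPowerSeries (Fin 2) ℂ) :=
  coe_substHom _ (constantCoeff_shearVec hφ0) _

theorem coe_polyShear (i j : Fin 2) (c : ℂ) (α : ℕ) (k : Fin 2) :
    (polyShear i j c α k : MvPowerSeries (Fin 2) ℂ) = shearVec i (C c * X j ^ α) k := by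
  rcases eq_or_ne k i with rfl | hk
  · simp [polyShear, shearVec]
  · simp [polyShear, shearVec, hk]

theorem coeff_C_mul_X_pow_ne_zero {j : Fin 2} (c : ℂ) (α : ℕ) (m : Fin 2 →₀ ℕ)
    (hm : coeff m (C c * X j ^ α : MvPowerSeries (Fin 2) ℂ) ≠ 0) : m = Finsupp.single j α := by
  classical
  rw [coeff_C_mul, coeff_X_pow] at hm
  exact by_contra fun h => hm (by rw [if_neg h, mul_zero])

theorem coe_aeval_polyShear (i j : Fin 2) (c : ℂ) (α : ℕ) (p : MvPolynomial (Fin 2) ℂ) :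
    (MvPolynomial.aeval (polyShear i j c α) p : MvPowerSeries (Fin 2) ℂ) =
      subst (shearVec i (C c * X j ^ α)) (p : MvPowerSeries (Fin 2) ℂ) := by
  rw [subst_coe, coe_aeval]
  exact congrArg (fun a => MvPolynomial.aeval a p) (funext (coe_polyShear i j c α))

/-- After a shear that creates the factor `x`, the cofactor has a finite Milnor number. -/
theorem hasFiniteMilnorNumber_of_aeval_polyShear {i j : Fin 2} (hij : i ≠ j) {c : ℂ} {α : ℕ}
    (hα : 0 < α) {w : Fin 2 → ℕ} {p q : MvPolynomial (Fin 2) ℂ} {n : ℕ} (hn : n ≠ 0)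
    (hq : MvPolynomial.IsWeightedHomogeneous w q n)
    (h : MvPolynomial.aeval (polyShear i j c α) p = MvPolynomial.X i * q)
    (hM : HasFiniteMilnorNumber (ofPoly p)) : HasFiniteMilnorNumber (ofPoly q) := by
  let I : Ideal (MvPolynomial (Fin 2) ℂ) := Ideal.span (Set.range fun k => MvPolynomial.pderiv k q)
  have hder : ∀ k, MvPolynomial.pderiv k q ∈ I := fun k => Ideal.subset_span ⟨k, rfl⟩
  -- Euler's relation puts q in its own Jacobian ideal; this needs the weighted degree n to be
  -- nonzero.
  have hqI : q ∈ I := by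
    have h1 := hq.sum_weight_X_mul_pderiv
    have h2 : MvPolynomial.C (n : ℂ) * q ∈ I := by
      rw [MvPolynomial.C_eq_coe_nat, ← nsmul_eq_mul, ← h1]
      exact sum_mem fun k _ => nsmul_mem (Ideal.mul_mem_left _ _ (hder k)) _
    have h3 := I.mul_mem_left (MvPolynomial.C (n : ℂ)⁻¹) h2
    rwa [← mul_assoc, ← map_mul, inv_mul_cancel₀ (by exact_mod_cast hn), map_one, one_mul] at h3
  have hsi : polyShear i j c α i =
      MvPolynomial.X i + MvPolynomial.C c * MvPolynomial.X j ^ α := Function.update_self ..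
  have hsj : polyShear i j c α j = MvPolynomial.X j := Function.update_of_ne hij.symm ..
  have hsum : ∀ F : Fin 2 → MvPolynomial (Fin 2) ℂ, ∑ k, F k = F i + F j := by
    intro F
    rw [Fin.sum_univ_two]
    fin_cases i <;> fin_cases j <;> simp_all [add_comm]
  -- By the chain rule this pulled-back derivative is the x_i-derivative of x_i q, namely q + x_i
  -- ∂_i q.
  have hIi : MvPolynomial.aeval (polyShear i j c α) (MvPolynomial.pderiv i p) ∈ I := by
    have h1 := pderiv_aeval (polyShear i j c α) i p
    rw [h, hsum, hsi, hsj] at h1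
    simp only [Derivation.leibniz, map_add, MvPolynomial.pderiv_X_self, MvPolynomial.pderiv_C,
      MvPolynomial.pderiv_X_of_ne hij.symm, smul_eq_mul, mul_one, mul_zero, add_zero,
      Derivation.leibniz_pow, smul_zero] at h1
    rw [← h1]
    exact add_mem (Ideal.mul_mem_left _ _ (hder i)) hqI
  -- The x_j-derivative of x_i q is x_i ∂_j q. It differs from the pullback of ∂_j p by a multiple
  -- of the pullback of ∂_i p, already known to lie in I.
  have hIj : MvPolynomial.aeval (polyShear i j c α) (MvPolynomial.pderiv j p) ∈ I := by
    have h1 := pderiv_aeval (polyShear i j c α) j p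
    rw [h, hsum, hsi, hsj, MvPolynomial.pderiv_X_self, mul_one, Derivation.leibniz,
      MvPolynomial.pderiv_X_of_ne hij, smul_zero, add_zero, smul_eq_mul] at h1
    rw [← sub_eq_iff_eq_add'.mpr h1]
    exact sub_mem (Ideal.mul_mem_left _ _ (hder j)) (Ideal.mul_mem_right _ _ hIi)
  have hI : I.map ofPolyHom ≤ jacobianIdeal (ofPoly q) := by
    rw [Ideal.map_span, Ideal.span_le]
    rintro _ ⟨_, ⟨k, rfl⟩, rfl⟩
    refine Ideal.subset_span ⟨k, ?_⟩
    beta_reduce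
    rw [partialDeriv_ofPoly, ofPolyHom_apply]
  let φ : ConvergentSeries := ofPoly (MvPolynomial.C c * MvPolynomial.X j ^ α)
  have hφc : (φ : MvPowerSeries (Fin 2) ℂ) = C c * X j ^ α := by
    simp [φ, coe_ofPoly]
  have hφ0 : constantCoeff (φ : MvPowerSeries (Fin 2) ℂ) = 0 := by
    simp [hφc, hα.ne']
  have hφ : ∀ m, coeff m (φ : MvPowerSeries (Fin 2) ℂ) ≠ 0 → m i = 0 := by
    intro m hm
    rw [hφc] at hm
    rw [coeff_C_mul_X_pow_ne_zero c α m hm, Finsupp.single_eq_of_ne hij]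
  let Φ := shearEquiv hij φ hφ0 hφ
  have hΦ : ∀ r : MvPolynomial (Fin 2) ℂ,
      Φ (ofPoly r) = ofPolyHom (MvPolynomial.aeval (polyShear i j c α) r) := by
    intro r
    rw [ofPolyHom_apply]
    refine Subtype.ext ?_
    rw [coe_shearEquiv, hφc, coe_ofPoly, coe_ofPoly, coe_aeval_polyShear]
  -- The shear carries the Jacobian ideal of p into that of q, so the Milnor algebra of p surjects
  -- onto that of q.
  have hle : jacobianIdeal (ofPoly p) ≤
      (jacobianIdeal (ofPoly q)).comap (Φ : ConvergentSeries →ₐ[ℂ] ConvergentSeries) := by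
    rw [jacobianIdeal, Ideal.span_le]
    rintro _ ⟨k, rfl⟩
    rw [SetLike.mem_coe, Ideal.mem_comap]
    beta_reduce
    rw [partialDeriv_ofPoly, AlgEquiv.coe_toAlgHom, hΦ]
    refine hI (Ideal.mem_map_of_mem _ ?_)
    have : k = i ∨ k = j := by omega
    rcases this with rfl | rfl
    · exact hIi
    · exact hIj
  have : Module.Finite ℂ (ConvergentSeries ⧸ jacobianIdeal (ofPoly p)) := hM
  refine Module.Finite.of_surjective (Ideal.quotientMapₐ _ _ hle).toLinearMap ?_
  intro x
  obtain ⟨y, rfl⟩ := Ideal.Quotient.mk_surjective x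
  refine ⟨Ideal.Quotient.mk _ (Φ.symm y), ?_⟩
  change Ideal.Quotient.mk _ (Φ (Φ.symm y)) = _
  rw [AlgEquiv.apply_symm_apply]

end ConvergentSeries

/-! ### Facets of the Newton polyhedron and their primitive weights. -/

namespace ConvergentSeries

open MvPowerSeries

/-- The weight `w` defines a facet of the Newton boundary, on which it takes the value `d`. -/
def IsFacetWeight (f : MvPowerSeries (Fin 2) ℂ) (w : Fin 2 → ℕ) (d : ℕ) : Prop :=
  (∀ k, 0 < w k) ∧ (w 0).Coprime (w 1) ∧ f ∈ weightIdeal w d ∧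
    ∃ m m' : Fin 2 →₀ ℕ, m ≠ m' ∧ coeff m f ≠ 0 ∧ coeff m' f ≠ 0 ∧
      Finsupp.weight w m = d ∧ Finsupp.weight w m' = d

/-- The part of the Newton polyhedron on which the weight `w` takes the value `d`. -/
def weightFace (f : ConvergentSeries) (w : Fin 2 → ℕ) (d : ℕ) : Set (Fin 2 → ℝ) :=
  {p | p ∈ newtonPolyhedron f ∧ (w 0 : ℝ) * p 0 + w 1 * p 1 = d}

theorem exponentPoint_mem_newtonPolyhedron {f : ConvergentSeries} {m : Fin 2 →₀ ℕ}
    (hm : coeff m (f : MvPowerSeries (Fin 2) ℂ) ≠ 0) : exponentPoint m ∈ newtonPolyhedron f :=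
  subset_convexHull ℝ _ ⟨m, hm, le_rfl⟩

theorem exponentPoint_injective : Function.Injective exponentPoint := fun m n h => by
  ext k
  have : (m k : ℝ) = n k := congrFun h k
  exact_mod_cast this

theorem add_mem_newtonPolyhedron {f : ConvergentSeries} {p q : Fin 2 → ℝ}
    (hp : p ∈ newtonPolyhedron f) (hq : 0 ≤ q) : p + q ∈ newtonPolyhedron f := by
  have h : newtonPolyhedron f ⊆ (fun p => p + q) ⁻¹' newtonPolyhedron f := by
    refine convexHull_min ?_ ((convex_convexHull ℝ _).translate_preimage_left q)
    rintro x ⟨m, hm, hmx⟩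
    exact subset_convexHull ℝ _ ⟨m, hm, hmx.trans (le_add_of_nonneg_right hq)⟩
  exact h hp

theorem le_of_mem_newtonPolyhedron {f : ConvergentSeries} {u v d : ℝ} (hu : 0 ≤ u) (hv : 0 ≤ v)
    (hd : ∀ m : Fin 2 →₀ ℕ, coeff m (f : MvPowerSeries (Fin 2) ℂ) ≠ 0 → d ≤ u * m 0 + v * m 1)
    {p : Fin 2 → ℝ} (hp : p ∈ newtonPolyhedron f) : d ≤ u * p 0 + v * p 1 := by
  have h : newtonPolyhedron f ⊆ {p | d ≤ u * p 0 + v * p 1} := by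
    refine convexHull_min ?_ ?_
    · rintro x ⟨m, hm, hmx⟩
      have h0 : (m 0 : ℝ) ≤ x 0 := hmx 0
      have h1 : (m 1 : ℝ) ≤ x 1 := hmx 1
      refine (hd m hm).trans ?_
      gcongr
    · intro x hx y hy a b ha hb hab
      simp only [Set.mem_ofPred_eq, Pi.add_apply, Pi.smul_apply, smul_eq_mul] at hx hy ⊢
      obtain rfl : b = 1 - a := by linarith
      have h1 := mul_le_mul_of_nonneg_left hx ha
      have h2 := mul_le_mul_of_nonneg_left hy hb
      nlinarith
  exact h hp

/-- A compact face of the Newton polyhedron is the convex hull of its exponent points. -/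
theorem face_eq_convexHull {f : ConvergentSeries} {u v d : ℝ} (hu : 0 < u) (hv : 0 < v)
    (hd : ∀ m : Fin 2 →₀ ℕ, coeff m (f : MvPowerSeries (Fin 2) ℂ) ≠ 0 → d ≤ u * m 0 + v * m 1) :
    {p | p ∈ newtonPolyhedron f ∧ u * p 0 + v * p 1 = d} =
      convexHull ℝ (exponentPoint '' {m | coeff m (f : MvPowerSeries (Fin 2) ℂ) ≠ 0 ∧
        u * m 0 + v * m 1 = d}) := by
  set K := convexHull ℝ (exponentPoint '' {m | coeff m (f : MvPowerSeries (Fin 2) ℂ) ≠ 0 ∧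
        u * m 0 + v * m 1 = d}) with hK
  have hKd : ∀ p ∈ K, u * p 0 + v * p 1 = d := by
    have h : K ⊆ {p | u * p 0 + v * p 1 = d} := by
      refine convexHull_min ?_ ?_
      · rintro _ ⟨m, ⟨_, hm⟩, rfl⟩
        exact hm
      · intro x hx y hy a b ha hb hab
        simp only [Set.mem_ofPred_eq, Pi.add_apply, Pi.smul_apply, smul_eq_mul] at hx hy ⊢
        calc _ = a * (u * x 0 + v * x 1) + b * (u * y 0 + v * y 1) := by ring
          _ = d := by rw [hx, hy, ← add_mul, hab, one_mul]
    exact fun p hp => h hp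
  refine Set.Subset.antisymm ?_ ?_
  · rintro p ⟨hp, hpd⟩
    -- The open half-plane together with K is convex and contains every generator, so it contains
    -- the polyhedron; on the supporting line only K is left.
    have h : newtonPolyhedron f ⊆ {p | d < u * p 0 + v * p 1} ∪ K := by
      refine convexHull_min ?_ ?_
      · rintro x ⟨m, hm, hmx⟩
        have h0 : (m 0 : ℝ) ≤ x 0 := hmx 0
        have h1 : (m 1 : ℝ) ≤ x 1 := hmx 1
        have hmd := hd m hm
        have hu0 := mul_le_mul_of_nonneg_left h0 hu.le
        have hv1 := mul_le_mul_of_nonneg_left h1 hv.le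
        by_cases hlt : d < u * x 0 + v * x 1
        · exact .inl hlt
        · refine .inr (subset_convexHull ℝ _ ⟨m, ⟨hm, by linarith⟩, ?_⟩)
          have e0 : (m 0 : ℝ) = x 0 := mul_left_cancel₀ hu.ne' (by linarith)
          have e1 : (m 1 : ℝ) = x 1 := mul_left_cancel₀ hv.ne' (by linarith)
          funext k
          fin_cases k
          · exact e0
          · exact e1
      · intro x hx y hy a b ha hb hab
        -- The endpoints are split off because strictness of the inequality passes to the
        -- combination only with positive coefficients.
        rcases eq_or_lt_of_le ha with rfl | ha'
        · obtain rfl : b = 1 := by linarith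
          simpa using hy
        rcases eq_or_lt_of_le hb with rfl | hb'
        · obtain rfl : a = 1 := by linarith
          simpa using hx
        have key : ∀ z : Fin 2 → ℝ, z ∈ {p | d < u * p 0 + v * p 1} ∪ K →
            d ≤ u * z 0 + v * z 1 := by
          rintro z (hz | hz)
          · exact le_of_lt hz
          · exact (hKd z hz).ge
        have hx' := key x hx
        have hy' := key y hy
        have hsum : u * (a • x + b • y) 0 + v * (a • x + b • y) 1 =
            a * (u * x 0 + v * x 1) + b * (u * y 0 + v * y 1) := by
          simp only [Pi.add_apply, Pi.smul_apply, smul_eq_mul]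
          ring
        have hdd : d = a * d + b * d := by rw [← add_mul, hab, one_mul]
        rcases hx with hx | hx
        · left
          rw [Set.mem_ofPred_eq, hsum, hdd]
          exact add_lt_add_of_lt_of_le (mul_lt_mul_of_pos_left hx ha')
            (mul_le_mul_of_nonneg_left hy' hb)
        rcases hy with hy | hy
        · left
          rw [Set.mem_ofPred_eq, hsum, hdd]
          exact add_lt_add_of_le_of_lt (mul_le_mul_of_nonneg_left hx' ha)
            (mul_lt_mul_of_pos_left hy hb')
        · exact .inr (convex_convexHull ℝ _ hx hy ha hb hab)
    exact (h hp).resolve_left (fun hlt => (ne_of_gt hlt) hpd)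
  · intro p hp
    refine ⟨?_, hKd p hp⟩
    refine convexHull_min ?_ (convex_convexHull ℝ _) hp
    rintro _ ⟨m, ⟨hm, _⟩, rfl⟩
    exact exponentPoint_mem_newtonPolyhedron hm

theorem natCast_weight (w : Fin 2 → ℕ) (m : Fin 2 →₀ ℕ) :
    ((Finsupp.weight w m : ℕ) : ℝ) = w 0 * m 0 + w 1 * m 1 := by
  rw [weight_fin_two w m zero_ne_one]
  push_cast
  rfl

theorem exponentPoint_mem_weightFace {f : ConvergentSeries} {w : Fin 2 → ℕ} {d : ℕ}
    {m : Fin 2 →₀ ℕ} (hm : coeff m (f : MvPowerSeries (Fin 2) ℂ) ≠ 0) :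
    exponentPoint m ∈ weightFace f w d ↔ Finsupp.weight w m = d := by
  have h : exponentPoint m ∈ weightFace f w d ↔ (w 0 : ℝ) * m 0 + w 1 * m 1 = d :=
    ⟨fun h => h.2, fun h => ⟨exponentPoint_mem_newtonPolyhedron hm, h⟩⟩
  rw [h, ← natCast_weight]
  exact Nat.cast_inj

theorem facetJet_weightFace (f : ConvergentSeries) (w : Fin 2 → ℕ) (d : ℕ) :
    facetJet f (weightFace f w d) = weightedJet w d (f : MvPowerSeries (Fin 2) ℂ) := by
  classical
  unfold facetJet weightedJet
  refine finsum_congr fun m => ?_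
  by_cases hm : coeff m (f : MvPowerSeries (Fin 2) ℂ) = 0
  · simp [hm]
  · simp only [exponentPoint_mem_weightFace hm]

theorem IsFacetWeight.isWeightOf {f : ConvergentSeries} {w : Fin 2 → ℕ} {d : ℕ}
    (h : IsFacetWeight (f : MvPowerSeries (Fin 2) ℂ) w d) : IsWeightOf w (weightFace f w d) :=
  ⟨h.1 0, h.1 1, h.2.1, fun _ hp _ hq => hp.2.trans hq.2.symm⟩

theorem IsFacetWeight.isFacet {f : ConvergentSeries} {w : Fin 2 → ℕ} {d : ℕ}
    (h : IsFacetWeight (f : MvPowerSeries (Fin 2) ℂ) w d) : IsFacet f (weightFace f w d) := by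
  obtain ⟨hw, -, hf, m, m', hmm, hm, hm', hmd, hmd'⟩ := h
  have hd : ∀ m : Fin 2 →₀ ℕ, coeff m (f : MvPowerSeries (Fin 2) ℂ) ≠ 0 →
      (d : ℝ) ≤ w 0 * m 0 + w 1 * m 1 := fun m hm => by
    rw [← natCast_weight]
    exact_mod_cast hf m hm
  have hw0 : (0 : ℝ) < w 0 := by exact_mod_cast hw 0
  have hw1 : (0 : ℝ) < w 1 := by exact_mod_cast hw 1
  have hp := (exponentPoint_mem_weightFace (w := w) (d := d) hm).mpr hmd
  have hp' := (exponentPoint_mem_weightFace (w := w) (d := d) hm').mpr hmd'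
  -- Exposed faces are sets of maximizers, hence the sign: minimizing the weight is maximizing its
  -- negative.
  refine ⟨fun _ => ⟨-((w 0 : ℝ) • ContinuousLinearMap.proj (R := ℝ) (φ := fun _ : Fin 2 => ℝ) 0 +
    (w 1 : ℝ) • ContinuousLinearMap.proj (R := ℝ) (φ := fun _ : Fin 2 => ℝ) 1), ?_⟩, ?_,
    ⟨_, hp, _, hp', exponentPoint_injective.ne hmm⟩⟩
  · ext p
    have hl : ∀ x : Fin 2 → ℝ,
        (-((w 0 : ℝ) • ContinuousLinearMap.proj (R := ℝ) (φ := fun _ : Fin 2 => ℝ) 0 +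
          (w 1 : ℝ) • ContinuousLinearMap.proj (R := ℝ) (φ := fun _ : Fin 2 => ℝ) 1)) x =
          -((w 0 : ℝ) * x 0 + w 1 * x 1) := fun x => by
      simp
    simp only [Set.mem_ofPred_eq, hl, neg_le_neg_iff]
    constructor
    · rintro ⟨hpN, hpd⟩
      exact ⟨hpN, fun y hy => hpd.le.trans (le_of_mem_newtonPolyhedron hw0.le hw1.le hd hy)⟩
    · rintro ⟨hpN, hpd⟩
      refine ⟨hpN, le_antisymm ?_ (le_of_mem_newtonPolyhedron hw0.le hw1.le hd hpN)⟩
      exact (hpd _ hp.1).trans hp.2.le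
  · rw [weightFace, face_eq_convexHull hw0 hw1 hd]
    refine (((finite_weight_eq hw d).subset fun n hn => ?_).image _).isCompact_convexHull ℝ
    have := hn.2
    rw [← natCast_weight] at this
    exact_mod_cast this

/-- Every line with two lattice points and a positive normal vector has a primitive positive
integral normal vector. -/
theorem exists_weight_of_eq {u v : ℝ} (hu : 0 < u) (hv : 0 < v) {m m' : Fin 2 →₀ ℕ} (hmm : m ≠ m')
    (h : u * m 0 + v * m 1 = u * m' 0 + v * m' 1) :
    ∃ (w : Fin 2 → ℕ) (κ : ℝ), (∀ k, 0 < w k) ∧ (w 0).Coprime (w 1) ∧ 0 < κ ∧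
      u = κ * w 0 ∧ v = κ * w 1 := by
  wlog hlt : m' 0 < m 0 generalizing m m'
  · rcases (not_lt.mp hlt).lt_or_eq with hlt' | heq
    · exact this hmm.symm h.symm hlt'
    · refine absurd (finsupp_ext_fin_two zero_ne_one heq ?_) hmm
      rw [heq] at h
      have : (m 1 : ℝ) = m' 1 := mul_left_cancel₀ hv.ne' (by linarith)
      exact_mod_cast this
  have hlt1 : m 1 < m' 1 := by
    by_contra hge
    have h0 : (m' 0 : ℝ) < m 0 := by exact_mod_cast hlt
    have h1 : (m' 1 : ℝ) ≤ m 1 := by exact_mod_cast not_lt.mp hge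
    have := mul_lt_mul_of_pos_left h0 hu
    have := mul_le_mul_of_nonneg_left h1 hv.le
    linarith
  obtain ⟨a, ha⟩ := Nat.exists_eq_add_of_lt hlt
  obtain ⟨b, hb⟩ := Nat.exists_eq_add_of_lt hlt1
  -- The two points differ by (a + 1, -(b + 1)), so (b + 1, a + 1) is normal to the line; dividing
  -- it by the gcd gives the primitive normal (p, q).
  obtain ⟨g, p, q, hg, hpq, hp, hq⟩ := Nat.exists_coprime' (m := b + 1) (n := a + 1)
    (Nat.gcd_pos_of_pos_left _ b.succ_pos)
  have hab : u * (a + 1) = v * (b + 1) := by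
    rw [ha, hb] at h
    push_cast at h
    linarith
  have hp0 : 0 < p := Nat.pos_of_ne_zero (by rintro rfl; simp at hp)
  have hq0 : 0 < q := Nat.pos_of_ne_zero (by rintro rfl; simp at hq)
  have hpR : (0 : ℝ) < p := by exact_mod_cast hp0
  have hgR : (0 : ℝ) < g := by exact_mod_cast hg
  have hp' : (b : ℝ) + 1 = p * g := by exact_mod_cast hp
  have hq' : (a : ℝ) + 1 = q * g := by exact_mod_cast hq
  have huv : u * q = v * p := by
    rw [hp', hq'] at hab
    exact mul_right_cancel₀ hgR.ne' (by linarith)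
  refine ⟨![p, q], u / p, ?_, by simpa using hpq, div_pos hu hpR, ?_, ?_⟩
  · intro k
    fin_cases k
    · exact hp0
    · exact hq0
  · simp [div_mul_cancel₀ _ hpR.ne']
  · rw [Matrix.cons_val_one, Matrix.cons_val_fin_one, div_mul_eq_mul_div, huv,
      mul_div_cancel_right₀ _ hpR.ne']

/-- Compactness makes the exposing functional strictly negative on both coordinate directions. The
face is then the hull of the exponents on it, and being nontrivial it carries two of them, which
determine a primitive integral normal. -/
theorem IsFacet.exists_isFacetWeight {f : ConvergentSeries} {Δ : Set (Fin 2 → ℝ)}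
    (h : IsFacet f Δ) : ∃ (w : Fin 2 → ℕ) (d : ℕ),
      IsFacetWeight (f : MvPowerSeries (Fin 2) ℂ) w d ∧ Δ = weightFace f w d := by
  obtain ⟨hexp, hcomp, hnt⟩ := h
  obtain ⟨l, hl⟩ := hexp hnt.nonempty
  obtain ⟨p, hp⟩ := hnt.nonempty
  have hpN : p ∈ newtonPolyhedron f := by rw [hl] at hp; exact hp.1
  have hmax : ∀ y ∈ newtonPolyhedron f, l y ≤ l p := by rw [hl] at hp; exact hp.2
  have hsingle : ∀ (k : Fin 2) (t : ℝ), 0 ≤ t → p + Pi.single k t ∈ newtonPolyhedron f :=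
    fun k t ht => add_mem_newtonPolyhedron hpN (Pi.single_nonneg.mpr ht)
  have hlsingle : ∀ (k : Fin 2) (t : ℝ), l (Pi.single k t) = t * l (Pi.single k 1) := by
    intro k t
    rw [← smul_eq_mul, ← map_smul, ← Pi.single_smul, smul_eq_mul, mul_one]
  -- A functional constant along a coordinate direction would put a whole ray into the face.
  have hneg : ∀ k : Fin 2, 0 < -l (Pi.single k 1) := by
    intro k
    have h1 := hmax _ (hsingle k 1 zero_le_one)
    rw [map_add] at h1
    refine lt_of_le_of_ne (by linarith) fun h0 => ?_
    obtain ⟨B, hB⟩ := hcomp.bddAbove_image (continuous_apply k).continuousOn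
    have hmem : p + Pi.single k (|B - p k| + 1) ∈ Δ := by
      rw [hl]
      refine ⟨hsingle k _ (by positivity), fun y hy => (hmax y hy).trans_eq ?_⟩
      rw [map_add, hlsingle, neg_eq_zero.mp h0.symm, mul_zero, add_zero]
    have h2 := hB ⟨_, hmem, rfl⟩
    simp only [Pi.add_apply, Pi.single_eq_same] at h2
    have := le_abs_self (B - p k)
    linarith
  have hlx : ∀ x : Fin 2 → ℝ,
      l x = -(-l (Pi.single 0 1) * x 0 + -l (Pi.single 1 1) * x 1) := by
    intro x
    have hx : x = Pi.single 0 (x 0) + Pi.single 1 (x 1) := by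
      funext k
      fin_cases k <;> simp
    conv_lhs => rw [hx, map_add, hlsingle 0 (x 0), hlsingle 1 (x 1)]
    ring
  have hu := hneg 0
  have hv := hneg 1
  generalize -l (Pi.single 0 1) = u at hlx hu
  generalize -l (Pi.single 1 1) = v at hlx hv
  have hΔ : Δ = {q | q ∈ newtonPolyhedron f ∧ u * q 0 + v * q 1 = u * p 0 + v * p 1} := by
    rw [hl]
    ext q
    constructor
    · rintro ⟨hq, hq'⟩
      have h1 := hq' p hpN
      have h2 := hmax q hq
      simp only [hlx] at h1 h2
      exact ⟨hq, by linarith⟩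
    · rintro ⟨hq, hq'⟩
      refine ⟨hq, fun y hy => (hmax y hy).trans_eq ?_⟩
      rw [hlx, hlx q, hq']
  have hd : ∀ m : Fin 2 →₀ ℕ, coeff m (f : MvPowerSeries (Fin 2) ℂ) ≠ 0 →
      u * p 0 + v * p 1 ≤ u * m 0 + v * m 1 := by
    intro m hm
    have := hmax _ (exponentPoint_mem_newtonPolyhedron hm)
    rw [hlx, hlx p] at this
    simp only [exponentPoint] at this
    linarith
  obtain ⟨m, hm, m', hm', hmm⟩ : {m : Fin 2 →₀ ℕ |
      coeff m (f : MvPowerSeries (Fin 2) ℂ) ≠ 0 ∧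
        u * m 0 + v * m 1 = u * p 0 + v * p 1}.Nontrivial := by
    by_contra hns
    rw [Set.not_nontrivial_iff] at hns
    rw [hΔ, face_eq_convexHull hu hv hd] at hnt
    rcases hns.eq_empty_or_singleton with h0 | ⟨x, h0⟩
    · rw [h0] at hnt
      simp at hnt
    · rw [h0] at hnt
      simp at hnt
  obtain ⟨w, κ, hw, hcop, hκ, rfl, rfl⟩ := exists_weight_of_eq hu hv hmm (hm.2.trans hm'.2.symm)
  have hval : ∀ x y : ℝ, κ * w 0 * x + κ * w 1 * y = κ * (w 0 * x + w 1 * y) := fun x y => by ring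
  simp only [hval] at hm hm' hd hΔ
  have hmd := mul_left_cancel₀ hκ.ne' hm.2
  refine ⟨w, Finsupp.weight w m, ⟨hw, hcop, fun n hn => ?_, m, m', hmm, hm.1, hm'.1, rfl, ?_⟩, ?_⟩
  · have := le_of_mul_le_mul_left (hd n hn) hκ
    rw [← hmd, ← natCast_weight, ← natCast_weight] at this
    exact_mod_cast this
  · have := (mul_left_cancel₀ hκ.ne' hm'.2).trans hmd.symm
    rw [← natCast_weight, ← natCast_weight] at this
    exact_mod_cast this
  · rw [hΔ, weightFace, natCast_weight, hmd]
    ext q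
    exact and_congr_right fun _ => mul_right_inj' hκ.ne'

/-- Non-degeneracy in terms of the weights of the facets. -/
theorem hasNondegenerateFacets_iff {f : ConvergentSeries} : HasNondegenerateFacets f ↔
    ∀ w d, IsFacetWeight (f : MvPowerSeries (Fin 2) ℂ) w d →
      ∃ h, IsSaturation (weightedJet w d (f : MvPowerSeries (Fin 2) ℂ)) h ∧
        HasFiniteMilnorNumber (ofPoly h) := by
  constructor
  · intro h w d hwd
    rw [← facetJet_weightFace]
    exact h _ hwd.isFacet
  · intro h Δ hΔ
    obtain ⟨w, d, hwd, rfl⟩ := hΔ.exists_isFacetWeight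
    rw [facetJet_weightFace]
    exact h w d hwd

end ConvergentSeries

/-! ### Factors of weighted homogeneous polynomials, and normalization without smooth facets. -/

namespace ConvergentSeries

open MvPolynomial

theorem X_dvd_iff_coeff {i : Fin 2} {p : MvPolynomial (Fin 2) ℂ} :
    X i ∣ p ↔ ∀ m, coeff m p ≠ 0 → m i ≠ 0 := by
  constructor
  · rintro ⟨q, rfl⟩ m hm hmi
    rw [coeff_X_mul', if_neg (by simpa using hmi)] at hm
    exact hm rfl
  · intro h
    rw [X_dvd_iff_modMonomial_eq_zero]
    ext m
    rw [coeff_zero]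
    by_cases hle : Finsupp.single i 1 ≤ m
    · exact coeff_modMonomial_of_le p hle
    · rw [coeff_modMonomial_of_not_le p hle]
      by_contra hm
      refine hle (Finsupp.single_le_iff.mpr ?_)
      exact Nat.one_le_iff_ne_zero.mpr (h m hm)

theorem exists_coeff_ne_zero_of_not_X_dvd {i : Fin 2} {p : MvPolynomial (Fin 2) ℂ}
    (h : ¬ X i ∣ p) : ∃ m, coeff m p ≠ 0 ∧ m i = 0 := by
  rw [X_dvd_iff_coeff] at h
  push Not at h
  exact h

/-- Weighted homogeneous polynomials of degree zero are constant. -/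
theorem eq_C_of_isWeightedHomogeneous_zero {w : Fin 2 → ℕ} (hw : ∀ k, 0 < w k)
    {p : MvPolynomial (Fin 2) ℂ} (hp : IsWeightedHomogeneous w p 0) : p = C (coeff 0 p) := by
  ext k
  rw [coeff_C]
  split_ifs with hk
  · rw [hk]
  · by_contra hne
    have h1 := hp hne
    rw [weight_fin_two w k zero_ne_one] at h1
    have h2 := hw 0
    have h3 := hw 1
    refine hk (finsupp_ext_fin_two zero_ne_one ?_ ?_)
    · have : w 0 * k 0 = 0 := by omega
      simpa [h2.ne', eq_comm] using this
    · have : w 1 * k 1 = 0 := by omega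
      simpa [h3.ne', eq_comm] using this

/-- A weighted homogeneous non-unit not divisible by `y` contains a power of `x`. -/
theorem exists_pow_coeff_ne_zero {w : Fin 2 → ℕ} (hw : ∀ k, 0 < w k) {p : MvPolynomial (Fin 2) ℂ}
    {n : ℕ} (hp : IsWeightedHomogeneous w p n) (hu : ¬ IsUnit p) {i j : Fin 2} (hij : i ≠ j)
    (hj : ¬ X j ∣ p) : ∃ m, coeff m p ≠ 0 ∧ m j = 0 ∧ 0 < m i := by
  obtain ⟨m, hm, hmj⟩ := exists_coeff_ne_zero_of_not_X_dvd hj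
  refine ⟨m, hm, hmj, Nat.pos_of_ne_zero fun hmi => hu ?_⟩
  have h0 : m = 0 := finsupp_ext_fin_two hij hmi hmj
  have hn : n = 0 := by rw [← hp hm, h0, map_zero]
  rw [hn] at hp
  rw [eq_C_of_isWeightedHomogeneous_zero hw hp]
  rw [h0] at hm
  exact (isUnit_iff_ne_zero.mpr hm).map C

/-- A weighted homogeneous non-unit not divisible by `y` has a zero with `y = 1`. -/
theorem exists_eval_eq_zero {w : Fin 2 → ℕ} (hw : ∀ k, 0 < w k) {p : MvPolynomial (Fin 2) ℂ}
    {n : ℕ} (hp : IsWeightedHomogeneous w p n) (hu : ¬ IsUnit p) {i j : Fin 2} (hij : i ≠ j)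
    (hj : ¬ X j ∣ p) : ∃ P : Fin 2 → ℂ, P j = 1 ∧ eval P p = 0 := by
  classical
  obtain ⟨m, hm, hmj, hmi⟩ := exists_pow_coeff_ne_zero hw hp hu hij hj
  set s : Fin 2 → Polynomial ℂ := Function.update (fun _ => 1) i Polynomial.X with hs
  have hprod : ∀ k : Fin 2 →₀ ℕ, (∏ t, s t ^ k t) = Polynomial.X ^ k i := by
    intro k
    rw [← Finsupp.prod_fintype k (fun t e => s t ^ e) (by simp), prod_fin_two s k hij, hs]
    simp [Function.update_of_ne hij.symm]
  -- After setting x_j = 1 no cancellation occurs: homogeneity allows only one monomial with a given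
  -- x_i-exponent. The pure power of x_i therefore survives, and the dehomogenization is
  -- non-constant.
  have hcoeff : (aeval s p).coeff (m i) = coeff m p := by
    rw [aeval_def, eval₂_eq', Polynomial.finsetSum_coeff, Finset.sum_eq_single m]
    · rw [hprod, Polynomial.algebraMap_apply, Algebra.algebraMap_self, RingHom.id_apply,
        Polynomial.coeff_C_mul, Polynomial.coeff_X_pow_self, mul_one]
    · intro k hk hkm
      rw [hprod, Polynomial.algebraMap_apply, Polynomial.coeff_C_mul, Polynomial.coeff_X_pow,
        if_neg, mul_zero]
      intro hki
      refine hkm (finsupp_ext_fin_two hij hki.symm ?_)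
      have h1 := hp (mem_support_iff.mp hk)
      rw [← hp hm, weight_fin_two w k hij, weight_fin_two w m hij, hki] at h1
      exact Nat.eq_of_mul_eq_mul_left (hw j) (by omega)
    · intro h
      rw [notMem_support_iff.mp h]
      simp
  have hdeg : (aeval s p).degree ≠ 0 := by
    intro h0
    have h1 := Polynomial.le_natDegree_of_ne_zero (hcoeff.trans_ne hm)
    have h2 : (aeval s p).natDegree = 0 := Polynomial.natDegree_eq_of_degree_eq_some h0
    omega
  obtain ⟨t, ht⟩ := IsAlgClosed.exists_root (aeval s p) hdeg
  refine ⟨Function.update (fun _ => 1) i t, Function.update_of_ne hij.symm _ _, ?_⟩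
  have hcomp : (Polynomial.aeval t).comp (aeval s) =
      (aeval (Function.update (fun _ => 1) i t) : MvPolynomial (Fin 2) ℂ →ₐ[ℂ] ℂ) := by
    refine algHom_ext fun k => ?_
    rcases eq_or_ne k i with rfl | hk
    · simp [hs]
    · simp [hs, hk]
  have h := DFunLike.congr_fun hcomp p
  rw [AlgHom.comp_apply, Polynomial.coe_aeval_eq_eval, ht.eq_zero] at h
  rw [h, aeval_eq_eval]

/-- Neither variable divides p, so p contains x_i and some x_j^e of equal weight. Then w_i = w_j e,
and coprimality leaves only w_j = 1. -/
theorem weight_eq_one_of_degreeOf_eq_one {w : Fin 2 → ℕ} (hw : ∀ k, 0 < w k)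
    {p : MvPolynomial (Fin 2) ℂ} {n : ℕ} (hp : IsWeightedHomogeneous w p n) (hu : ¬ IsUnit p)
    {i j : Fin 2} (hij : i ≠ j) (hcop : (w i).Coprime (w j)) (hi : ¬ X i ∣ p) (hj : ¬ X j ∣ p)
    (hdeg : degreeOf i p = 1) : w j = 1 := by
  obtain ⟨m, hm, hmj, hmi⟩ := exists_pow_coeff_ne_zero hw hp hu hij hj
  obtain ⟨k, hk, hki, hkj⟩ := exists_pow_coeff_ne_zero hw hp hu hij.symm hi
  have h1 := monomial_le_degreeOf i (mem_support_iff.mpr hm)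
  have hmi1 : m i = 1 := by omega
  have h2 := (hp hm).trans (hp hk).symm
  rw [weight_fin_two w m hij, weight_fin_two w k hij, hmj, hki, hmi1, mul_one, mul_zero, mul_zero,
    add_zero, zero_add] at h2
  exact Nat.eq_one_of_dvd_coprimes hcop ⟨k j, h2⟩ dvd_rfl

/-- The homogenization homomorphism `x_k ↦ x_k t ^ w_k`. -/
noncomputable def weightHomogenize (w : Fin 2 → ℕ) :
    MvPolynomial (Fin 2) ℂ →ₐ[ℂ] Polynomial (MvPolynomial (Fin 2) ℂ) :=
  aeval fun k => Polynomial.C (X k) * Polynomial.X ^ w k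

theorem coeff_weightHomogenize (w : Fin 2 → ℕ) (p : MvPolynomial (Fin 2) ℂ) (n : ℕ)
    (m : Fin 2 →₀ ℕ) : coeff m ((weightHomogenize w p).coeff n) =
      if Finsupp.weight w m = n then coeff m p else 0 := by
  induction p using MvPolynomial.induction_on' with
  | monomial k c =>
    have h : weightHomogenize w (monomial k c) =
        Polynomial.C (monomial k c) * Polynomial.X ^ Finsupp.weight w k := by
      rw [weightHomogenize, aeval_monomial, prod_fin_two _ k zero_ne_one,
        weight_fin_two w k zero_ne_one, monomial_eq, prod_fin_two _ k zero_ne_one,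
        Polynomial.algebraMap_apply, MvPolynomial.algebraMap_eq]
      simp only [map_mul, map_pow, mul_pow, pow_add, pow_mul]
      ring
    rw [h, Polynomial.coeff_C_mul, Polynomial.coeff_X_pow, mul_ite, mul_one, mul_zero]
    by_cases hkm : k = m
    · subst hkm
      simp only [eq_comm (a := n)]
      split_ifs <;> simp
    · rw [coeff_monomial, if_neg hkm, ite_self]
      split_ifs
      · rw [coeff_monomial, if_neg hkm]
      · rw [coeff_zero]
  | add p q hp hq =>
    rw [map_add, Polynomial.coeff_add, coeff_add, hp, hq, coeff_add]
    split_ifs <;> simp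

/-- The factors of weighted homogeneous polynomials are weighted homogeneous. -/
theorem exists_isWeightedHomogeneous_of_mul {w : Fin 2 → ℕ} {p q : MvPolynomial (Fin 2) ℂ} {n : ℕ}
    (h : IsWeightedHomogeneous w (p * q) n) (h0 : p * q ≠ 0) :
    ∃ a, IsWeightedHomogeneous w p a := by
  have hinj : ∀ r : MvPolynomial (Fin 2) ℂ, r ≠ 0 → weightHomogenize w r ≠ 0 := by
    intro r hr hz
    obtain ⟨m, hm⟩ := ne_zero_iff.mp hr
    have := coeff_weightHomogenize w r (Finsupp.weight w m) m
    rw [hz, Polynomial.coeff_zero, coeff_zero, if_pos rfl] at this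
    exact hm this.symm
  have hp := hinj p (left_ne_zero_of_mul h0)
  have hq := hinj q (right_ne_zero_of_mul h0)
  have hpq : weightHomogenize w (p * q) = Polynomial.monomial n (p * q) := by
    ext k m
    rw [coeff_weightHomogenize, Polynomial.coeff_monomial]
    split_ifs with h1 h2 h2
    · rfl
    · rw [coeff_zero]
      by_contra hne
      exact h2 ((h hne).symm.trans h1)
    · exact (h.coeff_eq_zero m (by omega)).symm
    · rw [coeff_zero]
  -- Degree and trailing degree in t are both additive over a domain, and they agree for the
  -- product. Hence they agree for each factor.
  have hdeg := congrArg Polynomial.natDegree hpq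
  have htr := congrArg Polynomial.natTrailingDegree hpq
  rw [map_mul, Polynomial.natDegree_mul hp hq, Polynomial.natDegree_monomial, if_neg h0] at hdeg
  rw [map_mul, Polynomial.natTrailingDegree_mul hp hq, Polynomial.natTrailingDegree_monomial h0]
    at htr
  have hp1 := Polynomial.natTrailingDegree_le_natDegree (weightHomogenize w p)
  have hq1 := Polynomial.natTrailingDegree_le_natDegree (weightHomogenize w q)
  refine ⟨(weightHomogenize w p).natDegree, fun {m} hm => ?_⟩
  have hne : (weightHomogenize w p).coeff (Finsupp.weight w m) ≠ 0 := by
    intro hz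
    have := coeff_weightHomogenize w p (Finsupp.weight w m) m
    rw [hz, coeff_zero, if_pos rfl] at this
    exact hm this.symm
  have h1 := Polynomial.le_natDegree_of_ne_zero hne
  have h2 := Polynomial.natTrailingDegree_le_of_ne_zero hne
  omega

/-- Two associated entries at different positions would make the square of one of them divide the
product. -/
theorem pairwise_not_associated {M : Type*} [CommMonoid M] {L : List M}
    (h : ∀ p ∈ L, ¬ p * p ∣ L.prod) : L.Pairwise fun p q => ¬ Associated p q := by
  induction L with
  | nil => exact List.Pairwise.nil
  | cons a L ih =>
    rw [List.prod_cons] at h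
    refine List.pairwise_cons.mpr ⟨fun b hb hab => ?_, ih fun p hp hdvd => ?_⟩
    · exact h a List.mem_cons_self (mul_dvd_mul_left a (hab.dvd.trans (List.dvd_prod hb)))
    · exact h p (List.mem_cons_of_mem _ hp) (hdvd.mul_left a)

/-- The facet of `f` meeting the axis `x_i = 0` comes from smooth branches transverse to the other
axis. -/
def HasSmoothFacetAt (f : MvPowerSeries (Fin 2) ℂ) (i : Fin 2) : Prop :=
  ∃ w d, IsFacetWeight f w d ∧ (∀ j, j ≠ i → w j = 1) ∧
    ∃ m : Fin 2 →₀ ℕ, MvPowerSeries.coeff m f ≠ 0 ∧ Finsupp.weight w m = d ∧ m i = 0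

/-- A constant cofactor would leave the jet a single monomial, whereas a facet carries two
exponents. -/
theorem not_isUnit_of_isSaturation {f : MvPowerSeries (Fin 2) ℂ} {w : Fin 2 → ℕ} {d : ℕ}
    (hwd : IsFacetWeight f w d) {k l : ℕ} {h : MvPolynomial (Fin 2) ℂ}
    (hkl : weightedJet w d f = X 0 ^ k * X 1 ^ l * h) : ¬ IsUnit h := by
  obtain ⟨hw, -, -, m, m', hmm, hm, hm', hmd, hmd'⟩ := hwd
  intro hu
  obtain ⟨c, hc, rfl⟩ := isUnit_iff_eq_C_of_isReduced.mp hu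
  have hmon : weightedJet w d f = monomial (Finsupp.single 0 k + Finsupp.single 1 l) c := by
    rw [hkl, X_pow_eq_monomial, X_pow_eq_monomial, monomial_mul, mul_comm, C_mul_monomial]
    simp
  have key : ∀ n, MvPowerSeries.coeff n f ≠ 0 → Finsupp.weight w n = d →
      Finsupp.single 0 k + Finsupp.single 1 l = n := by
    intro n hn hnd
    by_contra hne
    have h1 := coeff_weightedJet hw d f n
    rw [hmon, coeff_monomial, if_neg hne, if_pos hnd] at h1
    exact hn h1.symm
  exact hmm ((key m hm hmd).symm.trans (key m' hm' hmd'))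

theorem isWeightedHomogeneous_of_isSaturation {f : MvPowerSeries (Fin 2) ℂ} {w : Fin 2 → ℕ} {d : ℕ}
    (hwd : IsFacetWeight f w d) {k l : ℕ} {h : MvPolynomial (Fin 2) ℂ}
    (hkl : weightedJet w d f = X 0 ^ k * X 1 ^ l * h) (h0 : h ≠ 0) :
    ∃ n, IsWeightedHomogeneous w h n := by
  have hF := isWeightedHomogeneous_weightedJet hwd.1 d f
  rw [hkl, mul_comm] at hF
  refine exists_isWeightedHomogeneous_of_mul hF (mul_ne_zero h0 (mul_ne_zero ?_ ?_)) <;>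
  exact pow_ne_zero _ (X_ne_zero _)

theorem exists_coeff_of_not_X_dvd_weightedJet {f : MvPowerSeries (Fin 2) ℂ} {w : Fin 2 → ℕ}
    (hw : ∀ k, 0 < w k) {d : ℕ} {i : Fin 2} (h : ¬ X i ∣ weightedJet w d f) :
    ∃ m : Fin 2 →₀ ℕ, MvPowerSeries.coeff m f ≠ 0 ∧ Finsupp.weight w m = d ∧ m i = 0 := by
  obtain ⟨m, hm, hmi⟩ := exists_coeff_ne_zero_of_not_X_dvd h
  rw [coeff_weightedJet hw] at hm
  split_ifs at hm with hmd
  · exact ⟨m, hm, hmd, hmi⟩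
  · exact absurd rfl hm

/-- Away from smooth branches the facets are normalized. -/
theorem isNormalizedAt_of_not_hasSmoothFacetAt {f : ConvergentSeries}
    (hnd : HasNondegenerateFacets f)
    (hs : ∀ i, ¬ HasSmoothFacetAt (f : MvPowerSeries (Fin 2) ℂ) i) {Δ : Set (Fin 2 → ℝ)}
    (hΔ : IsFacet f Δ) : IsNormalizedAt f Δ := by
  classical
  obtain ⟨w, d, hwd, rfl⟩ := hΔ.exists_isFacetWeight
  obtain ⟨h, ⟨⟨k, l, hkl⟩, hX0, hX1⟩, hM⟩ := hasNondegenerateFacets_iff.mp hnd w d hwd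
  have hw := hwd.1
  have h0 : h ≠ 0 := by rintro rfl; exact hX0 (dvd_zero _)
  have hu := not_isUnit_of_isSaturation hwd hkl
  obtain ⟨n, hn⟩ := isWeightedHomogeneous_of_isSaturation hwd hkl h0
  obtain ⟨S, hirr, hprod, -⟩ := (WfDvdMonoid.not_isUnit_iff_exists_factors_eq h h0).mp hu
  have hdvd : ∀ p ∈ S, p ∣ h := fun p hp => hprod ▸ Multiset.dvd_prod hp
  have hhom : ∀ p, p ∣ h → ∃ a, IsWeightedHomogeneous w p a := by
    rintro p ⟨q, rfl⟩
    exact exists_isWeightedHomogeneous_of_mul hn h0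
  have hndvd0 : ∀ p, p ∣ h → ¬ X 0 ∣ p := fun p hp hX => hX0 (hX.trans hp)
  have hndvd1 : ∀ p, p ∣ h → ¬ X 1 ∣ p := fun p hp hX => hX1 (hX.trans hp)
  -- A repeated factor p has a zero with second coordinate 1, and this point would be critical for
  -- h.
  have hsq : ∀ p ∈ S, ¬ p * p ∣ h := by
    rintro p hp ⟨q, hq⟩
    obtain ⟨a, ha⟩ := hhom p (hdvd p hp)
    obtain ⟨P, hP1, hP0⟩ := exists_eval_eq_zero hw ha (hirr p hp).not_isUnit zero_ne_one
      (hndvd1 p (hdvd p hp))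
    obtain ⟨t, ht⟩ := exists_eval_pderiv_ne_zero hw hn hM (P := P) (j := 1) (by simp [hP1])
    refine ht ?_
    rw [hq]
    simp [Derivation.leibniz, hP0]
  have hlist : ((S.filter IsLinearInOneVariable).toList.prod *
      (S.filter fun p => ¬ IsLinearInOneVariable p).toList.prod) = h := by
    rw [Multiset.prod_toList, Multiset.prod_toList, Multiset.prod_filter_mul_prod_filter_not, hprod]
  have hgs : ∀ p ∈ (S.filter IsLinearInOneVariable).toList, w 0 = 1 ∨ w 1 = 1 := by
    intro p hp
    rw [Multiset.mem_toList, Multiset.mem_filter] at hp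
    have hp' := hdvd p hp.1
    obtain ⟨a, ha⟩ := hhom p hp'
    rcases hp.2 with hlin | hlin
    · exact .inr (weight_eq_one_of_degreeOf_eq_one hw ha (hirr p hp.1).not_isUnit zero_ne_one
        hwd.2.1 (hndvd0 p hp') (hndvd1 p hp') hlin)
    · exact .inl (weight_eq_one_of_degreeOf_eq_one hw ha (hirr p hp.1).not_isUnit one_ne_zero
        hwd.2.1.symm (hndvd1 p hp') (hndvd0 p hp') hlin)
  -- k = 0 means that x does not divide the jet; together with w 1 = 1 this would be a smooth facet.
  -- The case of l is symmetric.
  have hk : k = 0 → w 1 ≠ 1 := by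
    rintro rfl hw1
    refine hs 0 ⟨w, d, hwd, fun j hj => ?_, exists_coeff_of_not_X_dvd_weightedJet hw ?_⟩
    · rwa [show j = 1 by omega]
    · rw [hkl, pow_zero, one_mul, (X_prime (R := ℂ) (i := (0 : Fin 2))).dvd_mul, not_or]
      refine ⟨fun hX => ?_, hX0⟩
      have := X_dvd_X.mp ((X_prime (R := ℂ) (i := (0 : Fin 2))).dvd_of_dvd_pow hX)
      omega
  have hl : l = 0 → w 0 ≠ 1 := by
    rintro rfl hw0
    refine hs 1 ⟨w, d, hwd, fun j hj => ?_, exists_coeff_of_not_X_dvd_weightedJet hw ?_⟩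
    · rwa [show j = 0 by omega]
    · rw [hkl, pow_zero, mul_one, (X_prime (R := ℂ) (i := (1 : Fin 2))).dvd_mul, not_or]
      refine ⟨fun hX => ?_, hX1⟩
      have := X_dvd_X.mp ((X_prime (R := ℂ) (i := (1 : Fin 2))).dvd_of_dvd_pow hX)
      omega
  refine ⟨w, hwd.isWeightOf, k, l, (S.filter IsLinearInOneVariable).toList,
    (S.filter fun p => ¬ IsLinearInOneVariable p).toList, ⟨?_, ?_, ?_, ?_⟩, ?_, ?_, ?_⟩
  · rw [facetJet_weightFace, hkl, mul_assoc, mul_assoc, mul_assoc, hlist]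
  · intro p hp
    rw [Multiset.mem_toList, Multiset.mem_filter] at hp
    have hp' := hdvd p hp.1
    exact ⟨hirr p hp.1, ⟨(hirr p hp.1).not_isUnit, hhom p hp'⟩, hp.2,
      fun ha => hndvd0 p hp' ha.symm.dvd, fun ha => hndvd1 p hp' ha.symm.dvd⟩
  · intro p hp
    rw [Multiset.mem_toList, Multiset.mem_filter] at hp
    exact ⟨hirr p hp.1, ⟨(hirr p hp.1).not_isUnit, hhom p (hdvd p hp.1)⟩, hp.2⟩
  · refine pairwise_not_associated fun p hp hpp => ?_
    rw [Multiset.mem_toList, Multiset.mem_filter] at hp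
    exact hsq p hp.1 (hpp.trans (Dvd.intro_left _ hlist))
  · intro heq
    have h1 : w 0 = 1 := by
      have := hwd.2.1
      rwa [heq, Nat.coprime_self, ← heq] at this
    exact ⟨fun hk0 => hk hk0 (heq ▸ h1), fun hl0 => hl hl0 h1⟩
  -- A linear factor forces one weight to be 1. Here w 0 exceeds w 1 ≥ 1, so it is w 1, contrary to
  -- `hk`.
  · intro hlt hk0
    by_contra hlen
    obtain ⟨p, hp⟩ := List.exists_mem_of_length_pos (Nat.pos_of_ne_zero hlen)
    have := hw 1
    rcases hgs p hp with h1 | h1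
    · omega
    · exact hk hk0 h1
  · intro hlt hl0
    by_contra hlen
    obtain ⟨p, hp⟩ := List.exists_mem_of_length_pos (Nat.pos_of_ne_zero hlen)
    have := hw 0
    rcases hgs p hp with h1 | h1
    · exact hl hl0 h1
    · omega

end ConvergentSeries

/-! ### Lifting simple zeros to smooth branches and straightening them. -/

namespace ConvergentSeries

open MvPowerSeries

/-- Setting `x = 0` does not change a series modulo `x`. -/
theorem coeff_eq_zero_of_subst_eq_zero {i : Fin 2} {f : MvPowerSeries (Fin 2) ℂ}
    (h : subst (Function.update X i (0 : MvPowerSeries (Fin 2) ℂ)) f = 0) {m : Fin 2 →₀ ℕ}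
    (hm : m i = 0) : coeff m f = 0 := by
  obtain ⟨j, hij⟩ : ∃ j, i ≠ j := ⟨i + 1, by fin_cases i <;> simp⟩
  have hs := hasSubst_update_X (i := i) (v := 0) (map_zero _)
  have h1 : subst X f - subst (Function.update X i (0 : MvPowerSeries (Fin 2) ℂ)) f ∈
      weightIdeal (Pi.single i 1) 1 := by
    refine subst_sub_subst_mem_weightIdeal HasSubst.X hs fun k => ?_
    rw [← mul_sub]
    refine C_mul_mem_weightIdeal _ ?_
    rw [prod_fin_two _ k hij, prod_fin_two _ k hij, Function.update_self,
      Function.update_of_ne hij.symm]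
    rcases Nat.eq_zero_or_pos (k i) with hk | hk
    · simp [hk]
    · rw [zero_pow hk.ne', zero_mul, sub_zero]
      refine Ideal.mul_mem_right _ _ (weightIdeal_anti hk ?_)
      have := pow_mem_weightIdeal (X_mem_weightIdeal (Pi.single i 1) i) (k i)
      rwa [Pi.single_eq_same, mul_one] at this
  rw [h, sub_zero, subst_self, id, mem_weightIdeal_single_iff] at h1
  by_contra hne
  have := h1 m hne
  omega

theorem X_pow_dvd_iff_mem_weightIdeal {j : Fin 2} {d : ℕ} {f : MvPowerSeries (Fin 2) ℂ} :
    X j ^ d ∣ f ↔ f ∈ weightIdeal (Pi.single j 1) d := by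
  rw [X_pow_dvd_iff, mem_weightIdeal_single_iff]
  exact forall_congr' fun m => by rw [← not_lt, not_imp_not]

theorem coeff_add_single_X_pow_mul (j : Fin 2) (d : ℕ) (e : Fin 2 →₀ ℕ)
    (f : MvPowerSeries (Fin 2) ℂ) : coeff (Finsupp.single j d + e) (X j ^ d * f) = coeff e f := by
  rw [X_pow_eq, coeff_add_monomial_mul, one_mul]

theorem isConvergent_of_X_pow_mul {j : Fin 2} {d : ℕ} {f : MvPowerSeries (Fin 2) ℂ}
    (h : IsConvergent (X j ^ d * f)) : IsConvergent f := by
  obtain ⟨r, hr, hs⟩ := h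
  refine ⟨r, hr, ?_⟩
  have h1 := (hs.comp_injective (add_right_injective (Finsupp.single j d))).mul_left (r ^ d)⁻¹
  refine h1.congr fun m => ?_
  simp only [Function.comp_apply]
  rw [coeff_add_single_X_pow_mul, map_add, Finsupp.degree_single, pow_add]
  field_simp

theorem isConvergent_C (c : ℂ) : IsConvergent (C c) := ConvergentSeries.algebraMap_mem c

theorem isConvergent_pow {f : MvPowerSeries (Fin 2) ℂ} (hf : IsConvergent f) (n : ℕ) :
    IsConvergent (f ^ n) := pow_mem (S := ConvergentSeries) hf n

theorem constantCoeff_coe (p : MvPolynomial (Fin 2) ℂ) :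
    constantCoeff (p : MvPowerSeries (Fin 2) ℂ) = MvPolynomial.eval 0 p := by
  rw [← coeff_zero_eq_constantCoeff_apply, MvPolynomial.coeff_coe, MvPolynomial.eval_zero,
    MvPolynomial.constantCoeff_eq]

theorem coeff_single_one_coe (p : MvPolynomial (Fin 2) ℂ) (i : Fin 2) :
    coeff (Finsupp.single i 1) (p : MvPowerSeries (Fin 2) ℂ) =
      MvPolynomial.eval 0 (MvPolynomial.pderiv i p) := by
  have h := coeff_pderiv (i := i) (p : MvPowerSeries (Fin 2) ℂ) 0
  rw [pderiv_coe, coeff_zero_eq_constantCoeff_apply, constantCoeff_coe] at h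
  simpa using h.symm

theorem eval_aeval (s : Fin 2 → MvPolynomial (Fin 2) ℂ) (Q : Fin 2 → ℂ)
    (p : MvPolynomial (Fin 2) ℂ) : MvPolynomial.eval Q (MvPolynomial.aeval s p) =
      MvPolynomial.eval (fun k => MvPolynomial.eval Q (s k)) p := by
  have h : (MvPolynomial.aeval Q).comp (MvPolynomial.aeval s) =
      (MvPolynomial.aeval (fun k => MvPolynomial.eval Q (s k)) :
        MvPolynomial (Fin 2) ℂ →ₐ[ℂ] ℂ) := by
    refine MvPolynomial.algHom_ext fun k => ?_
    rw [AlgHom.comp_apply, MvPolynomial.aeval_X, MvPolynomial.aeval_X, MvPolynomial.aeval_eq_eval]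
  have := DFunLike.congr_fun h p
  rwa [AlgHom.comp_apply, MvPolynomial.aeval_eq_eval, MvPolynomial.aeval_eq_eval] at this

/-- A simple zero of the jet of `f` along a facet of weight `(α, 1)` lifts to a smooth branch
`x = y ^ α * (c + u(y))` of `f`. -/
theorem exists_smooth_branch {i j : Fin 2} (hij : i ≠ j) {f : MvPowerSeries (Fin 2) ℂ}
    (hf : IsConvergent f) {w : Fin 2 → ℕ} (hw : ∀ k, 0 < w k) (hwj : w j = 1) {d : ℕ}
    (hfd : f ∈ weightIdeal w d) {P : Fin 2 → ℂ} (hPj : P j = 1)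
    (hP : MvPolynomial.eval P (weightedJet w d f) = 0)
    (hP' : MvPolynomial.eval P (MvPolynomial.pderiv i (weightedJet w d f)) ≠ 0) :
    ∃ u : MvPowerSeries (Fin 2) ℂ, IsConvergent u ∧ constantCoeff u = 0 ∧
      (∀ m, coeff m u ≠ 0 → m i = 0) ∧
      subst (Function.update X i (X j ^ w i * (C (P i) + u))) f = 0 := by
  set s : Fin 2 → MvPolynomial (Fin 2) ℂ :=
    Function.update (fun _ => 1) i (MvPolynomial.C (P i) + MvPolynomial.X i) with hs
  have hsi : s i = MvPolynomial.C (P i) + MvPolynomial.X i := Function.update_self ..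
  have hsj : s j = 1 := Function.update_of_ne hij.symm ..
  have hk2 : ∀ k, k = i ∨ k = j := fun k => by omega
  -- A chart of the weighted blow-up centred at P: x_i is replaced by x_j^α (P_i + x_i) with α = w
  -- i, and x_j stays as it is because w j = 1.
  set a : Fin 2 → MvPowerSeries (Fin 2) ℂ := fun k => X j ^ w k * (s k : MvPowerSeries (Fin 2) ℂ)
    with ha
  have hai : a i = X j ^ w i * (C (P i) + X i) := by simp [ha, hsi]
  have haj : a j = X j := by simp [ha, hsj, hwj]
  have ha0 : ∀ k, constantCoeff (a k) = 0 := fun k => by simp [ha, (hw k).ne']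
  have hsub : HasSubst a := hasSubst_of_constantCoeff_zero ha0
  have hac : ∀ k, IsConvergent (a k) := fun k =>
    isConvergent_mul (isConvergent_pow (isConvergent_X j) _) (isConvergent_coe _)
  have haw : ∀ k, a k ∈ weightIdeal (Pi.single j 1) (w k) := fun k =>
    X_pow_dvd_iff_mem_weightIdeal.mp (Dvd.intro _ rfl)
  -- The pullback of f is divisible by x_j^d; G is the strict transform.
  obtain ⟨G, hG⟩ := X_pow_dvd_iff_mem_weightIdeal.mpr
    (subst_mem_weightIdeal_of_weight hsub haw hfd)
  have hGc : IsConvergent G := by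
    have := isConvergent_subst hac ha0 hf
    rw [hG] at this
    exact isConvergent_of_X_pow_mul this
  have hcong := subst_sub_subst_weightedJet_mem hw hsub hsub haw haw (fun k => by simp) hfd
  rw [hG, subst_coe, ha, aeval_pow_mul_of_isWeightedHomogeneous
    (isWeightedHomogeneous_weightedJet hw d f) (fun k => (s k : MvPowerSeries (Fin 2) ℂ)),
    ← coe_aeval, ← mul_sub, mem_weightIdeal_single_iff] at hcong
  -- On the exceptional line x_j = 0, G is the jet at (P_i + x_i, 1). Its value and x_i-derivative
  -- at the origin are those of the jet at P, as the implicit function theorem requires.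
  have hcoeff : ∀ e : Fin 2 →₀ ℕ, e j = 0 → coeff e G =
      coeff e (MvPolynomial.aeval s (weightedJet w d f) : MvPowerSeries (Fin 2) ℂ) := by
    intro e he
    by_contra hne
    have := hcong (Finsupp.single j d + e)
      (by rw [coeff_add_single_X_pow_mul, map_sub]; exact sub_ne_zero.mpr hne)
    simp [he] at this
  have hev : (fun k => MvPolynomial.eval 0 (s k)) = P := by
    funext k
    rcases hk2 k with rfl | rfl
    · simp [hsi]
    · simp [hsj, hPj]
  have hG0 : constantCoeff G = 0 := by
    rw [← coeff_zero_eq_constantCoeff_apply, hcoeff 0 rfl, coeff_zero_eq_constantCoeff_apply,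
      constantCoeff_coe, eval_aeval, hev, hP]
  have hG1 : coeff (Finsupp.single i 1) G ≠ 0 := by
    rw [hcoeff _ (Finsupp.single_eq_of_ne hij.symm), coeff_single_one_coe, pderiv_aeval, map_sum,
      Finset.sum_eq_single i]
    · rw [map_mul, eval_aeval, hev, hsi]
      simpa using hP'
    · intro k _ hk
      rw [(hk2 k).resolve_left hk, hsj]
      simp
    · simp
  obtain ⟨u, huc, hu0, hui, hGu⟩ := exists_subst_update_eq_zero hij hGc hG0 hG1
  refine ⟨u, huc, hu0, hui, ?_⟩
  have hsu := hasSubst_update_X (i := i) hu0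
  have h1 : subst (Function.update X i u) (subst a f) = 0 := by
    rw [hG, subst_mul hsu, hGu, mul_zero]
  rw [subst_comp_subst_apply hsub hsu] at h1
  convert h1 using 2
  funext k
  rcases hk2 k with rfl | rfl
  · rw [Function.update_self, hai, subst_mul hsu, subst_pow hsu, subst_X hsu, subst_add hsu,
      subst_C, subst_X hsu, Function.update_self, Function.update_of_ne hij.symm]
  · rw [Function.update_of_ne hij.symm, haj, subst_X hsu, Function.update_of_ne hij.symm]

/-- Straightening the branch `x = φ(y)` of `f` makes `x` a factor. -/
theorem ne_zero_of_coeff_subst_shearVec_ne_zero {i j : Fin 2} (hij : i ≠ j)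
    {f φ : MvPowerSeries (Fin 2) ℂ} (hφ0 : constantCoeff φ = 0)
    (hφ : ∀ m, coeff m φ ≠ 0 → m i = 0) (h : subst (Function.update X i φ) f = 0)
    {m : Fin 2 →₀ ℕ} (hm : coeff m (subst (shearVec i φ) f) ≠ 0) : m i ≠ 0 := by
  intro hmi
  refine hm (coeff_eq_zero_of_subst_eq_zero (i := i) ?_ hmi)
  have hs := hasSubst_shearVec (i := i) hφ0
  have hz := hasSubst_update_X (i := i) (v := 0) (map_zero _)
  rw [subst_comp_subst_apply hs hz]
  refine Eq.trans (congrArg (fun a => subst a f) (funext fun k => ?_)) h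
  rcases eq_or_ne k i with rfl | hk
  · rw [shearVec_self, subst_add hz, subst_X hz, Function.update_self, Function.update_self,
      zero_add, subst_congr_of_forall_eq_zero hij hz HasSubst.X
        (Function.update_of_ne hij.symm _ _) hφ, subst_self, id]
  · rw [shearVec_of_ne hk, subst_X hz, Function.update_of_ne hk, Function.update_of_ne hk]

/-- The shear fixes x_j, so divisibility by x_j persists. This lets a second straightening keep the
result of the first. -/
theorem ne_zero_of_coeff_subst_shearVec_ne_zero' {i j : Fin 2} (hij : i ≠ j)
    {f φ : MvPowerSeries (Fin 2) ℂ} (hφ0 : constantCoeff φ = 0)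
    (h : ∀ m, coeff m f ≠ 0 → m j ≠ 0)
    {m : Fin 2 →₀ ℕ} (hm : coeff m (subst (shearVec i φ) f) ≠ 0) : m j ≠ 0 := by
  have hf : f ∈ weightIdeal (Pi.single j 1) 1 :=
    mem_weightIdeal_single_iff.mpr fun m hm => Nat.one_le_iff_ne_zero.mpr (h m hm)
  have hg := subst_mem_weightIdeal_of_weight (w := Pi.single j 1) (hasSubst_shearVec (i := i) hφ0)
    (fun k => by
      rcases eq_or_ne k i with rfl | hk
      · rw [Pi.single_eq_of_ne hij]
        exact mem_weightIdeal_zero _ _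
      · rw [shearVec_of_ne hk]
        exact X_mem_weightIdeal _ _) hf
  exact Nat.one_le_iff_ne_zero.mp (mem_weightIdeal_single_iff.mp hg m hm)

theorem shearVec_mem_weightIdeal {w : Fin 2 → ℕ} {i : Fin 2} {φ : MvPowerSeries (Fin 2) ℂ}
    (hφ : φ ∈ weightIdeal w (w i)) (k : Fin 2) : shearVec i φ k ∈ weightIdeal w (w k) := by
  rcases eq_or_ne k i with rfl | hk
  · rw [shearVec_self]
    exact add_mem (X_mem_weightIdeal _ _) hφ
  · rw [shearVec_of_ne hk]
    exact X_mem_weightIdeal _ _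

/-- A shear of higher order preserves the facets. -/
theorem isFacetWeight_of_subst_shearVec {w : Fin 2 → ℕ} {d : ℕ} {i : Fin 2}
    {g ψ : MvPowerSeries (Fin 2) ℂ} (hψ0 : constantCoeff ψ = 0)
    (hψ : ψ ∈ weightIdeal w (w i + 1)) (h : IsFacetWeight g w d) :
    IsFacetWeight (subst (shearVec i ψ) g) w d ∧
      weightedJet w d (subst (shearVec i ψ) g) = weightedJet w d g := by
  obtain ⟨hw, hcop, hg, m, m', hmm, hm, hm', hmd, hmd'⟩ := h
  have hs := hasSubst_shearVec (i := i) hψ0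
  have hψw := shearVec_mem_weightIdeal (weightIdeal_anti (w i).le_succ hψ)
  have hcong := subst_sub_subst_weightedJet_mem hw hs HasSubst.X hψw (X_mem_weightIdeal w)
    (fun k => by
      rcases eq_or_ne k i with rfl | hk
      · rw [shearVec_self, add_sub_cancel_left]
        exact hψ
      · rw [shearVec_of_ne hk, sub_self]
        exact zero_mem _) hg
  rw [subst_self, id] at hcong
  have hjet := weightedJet_eq_of_sub_mem hw hcong
  rw [weightedJet_coe hw (isWeightedHomogeneous_weightedJet hw d g)] at hjet
  have hcoeff : ∀ n, Finsupp.weight w n = d →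
      coeff n (subst (shearVec i ψ) g) = coeff n g := by
    intro n hn
    have := congrArg (MvPolynomial.coeff n) hjet
    rwa [coeff_weightedJet hw, coeff_weightedJet hw, if_pos hn, if_pos hn] at this
  refine ⟨⟨hw, hcop, subst_mem_weightIdeal_of_weight hs hψw hg, m, m', hmm, ?_, ?_, hmd, hmd'⟩,
    hjet⟩
  · rwa [hcoeff m hmd]
  · rwa [hcoeff m' hmd']

/-- `IsSaturation` names the variables 0 and 1; this lemma and its converse transfer it to an
unordered pair i, j. -/
theorem isSaturation_of_eq {i j : Fin 2} (hij : i ≠ j) {F s : MvPolynomial (Fin 2) ℂ} {a b : ℕ}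
    (hF : F = MvPolynomial.X i ^ a * MvPolynomial.X j ^ b * s) (hi : ¬ MvPolynomial.X i ∣ s)
    (hj : ¬ MvPolynomial.X j ∣ s) : IsSaturation F s := by
  have h : (i = 0 ∧ j = 1) ∨ (i = 1 ∧ j = 0) := by omega
  rcases h with ⟨rfl, rfl⟩ | ⟨rfl, rfl⟩
  · exact ⟨⟨a, b, hF⟩, hi, hj⟩
  · exact ⟨⟨b, a, by rw [hF]; ring⟩, hj, hi⟩

theorem IsSaturation.exists_eq {i j : Fin 2} (hij : i ≠ j) {F s : MvPolynomial (Fin 2) ℂ}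
    (h : IsSaturation F s) : (∃ a b : ℕ, F = MvPolynomial.X i ^ a * MvPolynomial.X j ^ b * s) ∧
      ¬ MvPolynomial.X i ∣ s ∧ ¬ MvPolynomial.X j ∣ s := by
  obtain ⟨⟨a, b, hF⟩, h0, h1⟩ := h
  have h : (i = 0 ∧ j = 1) ∨ (i = 1 ∧ j = 0) := by omega
  rcases h with ⟨rfl, rfl⟩ | ⟨rfl, rfl⟩
  · exact ⟨⟨a, b, hF⟩, h0, h1⟩
  · exact ⟨⟨b, a, by rw [hF]; ring⟩, h1, h0⟩

theorem not_X_dvd_X_pow {i j : Fin 2} (hij : i ≠ j) (l : ℕ) :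
    ¬ (MvPolynomial.X i : MvPolynomial (Fin 2) ℂ) ∣ MvPolynomial.X j ^ l := fun h =>
  hij (MvPolynomial.X_dvd_X.mp ((MvPolynomial.X_prime (R := ℂ) (i := i)).dvd_of_dvd_pow h))

theorem aeval_polyShear_X {i j : Fin 2} (hij : i ≠ j) (c : ℂ) (α : ℕ) :
    MvPolynomial.aeval (polyShear i j c α) (MvPolynomial.X j : MvPolynomial (Fin 2) ℂ) =
      MvPolynomial.X j := by
  rw [MvPolynomial.aeval_X, polyShear, Function.update_of_ne hij.symm]

theorem aeval_polyShear_neg {i j : Fin 2} (hij : i ≠ j) (c : ℂ) (α : ℕ)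
    (p : MvPolynomial (Fin 2) ℂ) : MvPolynomial.aeval (polyShear i j (-c) α)
      (MvPolynomial.aeval (polyShear i j c α) p) = p := by
  have h : (MvPolynomial.aeval (polyShear i j (-c) α)).comp
      (MvPolynomial.aeval (polyShear i j c α)) = AlgHom.id ℂ (MvPolynomial (Fin 2) ℂ) := by
    refine MvPolynomial.algHom_ext fun k => ?_
    rw [AlgHom.comp_apply, AlgHom.id_apply]
    rcases eq_or_ne k j with rfl | hk
    · rw [aeval_polyShear_X hij, aeval_polyShear_X hij]
    · obtain rfl : k = i := by omega
      have h1 : ∀ c : ℂ, polyShear k j c α k =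
          MvPolynomial.X k + MvPolynomial.C c * MvPolynomial.X j ^ α := fun c =>
        Function.update_self ..
      rw [MvPolynomial.aeval_X, h1, map_add, map_mul, map_pow, aeval_polyShear_X hij,
        MvPolynomial.aeval_X, h1]
      simp
  exact DFunLike.congr_fun h p

/-- A non-degenerate jet with weight `(α, 1)` has a simple zero. -/
theorem exists_simple_zero {i j : Fin 2} (hij : i ≠ j) {w : Fin 2 → ℕ} (hw : ∀ k, 0 < w k)
    {h : MvPolynomial (Fin 2) ℂ} {n : ℕ} (hn : MvPolynomial.IsWeightedHomogeneous w h n)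
    (hu : ¬ IsUnit h) (hj : ¬ MvPolynomial.X j ∣ h) (hM : HasFiniteMilnorNumber (ofPoly h)) :
    ∃ P : Fin 2 → ℂ, P j = 1 ∧ MvPolynomial.eval P h = 0 ∧
      MvPolynomial.eval P (MvPolynomial.pderiv i h) ≠ 0 := by
  obtain ⟨P, hPj, hP⟩ := exists_eval_eq_zero hw hn hu hij hj
  refine ⟨P, hPj, hP, fun hPi => ?_⟩
  obtain ⟨k, hk⟩ := exists_eval_pderiv_ne_zero hw hn hM (P := P) (j := j) (by simp [hPj])
  have hki : k ≠ i := by rintro rfl; exact hk hPi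
  obtain rfl : k = j := by omega
  -- Euler's relation at P: with h(P) = 0, ∂_i h(P) = 0 and P_j = 1, it forces the remaining
  -- derivative to vanish as well.
  have h1 := congrArg (MvPolynomial.eval P) hn.sum_weight_X_mul_pderiv
  rw [map_sum, Finset.sum_eq_single k] at h1
  · simp only [nsmul_eq_mul, map_mul, map_natCast, MvPolynomial.eval_X, hPj, hP, one_mul,
      mul_zero, mul_eq_zero, Nat.cast_eq_zero, (hw k).ne', false_or] at h1
    exact hk h1
  · intro b _ hb
    obtain rfl : b = i := by omega
    simp [hPi]
  · simp

theorem isWeightedHomogeneous_aeval {w v : Fin 2 → ℕ} {s : Fin 2 → MvPolynomial (Fin 2) ℂ}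
    (hs : ∀ k, MvPolynomial.IsWeightedHomogeneous w (s k) (v k)) {p : MvPolynomial (Fin 2) ℂ}
    {n : ℕ} (hp : MvPolynomial.IsWeightedHomogeneous v p n) :
    MvPolynomial.IsWeightedHomogeneous w (MvPolynomial.aeval s p) n := by
  rw [MvPolynomial.aeval_def, MvPolynomial.eval₂_eq', ← MvPolynomial.mem_weightedHomogeneousSubmodule]
  refine sum_mem fun m hm => ?_
  have h := hp (MvPolynomial.mem_support_iff.mp hm)
  rw [weight_fin_two v m zero_ne_one] at h
  rw [MvPolynomial.mem_weightedHomogeneousSubmodule, MvPolynomial.algebraMap_eq, Fin.prod_univ_two,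
    ← h, mul_comm (v 0), mul_comm (v 1)]
  exact (((hs 0).pow (m 0)).mul ((hs 1).pow (m 1))).C_mul _

theorem isWeightedHomogeneous_polyShear {i j : Fin 2} {w : Fin 2 → ℕ} {c : ℂ}
    (hwj : w j = 1) (k : Fin 2) :
    MvPolynomial.IsWeightedHomogeneous w (polyShear i j c (w i) k) (w k) := by
  rcases eq_or_ne k i with rfl | hk
  · rw [polyShear, Function.update_self]
    refine (MvPolynomial.isWeightedHomogeneous_X ℂ w k).add ?_
    have h := (MvPolynomial.isWeightedHomogeneous_X ℂ w j).pow (w k)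
    rw [hwj, smul_eq_mul, mul_one] at h
    exact h.C_mul c
  · rw [polyShear, Function.update_of_ne hk]
    exact MvPolynomial.isWeightedHomogeneous_X ℂ w k

/-- A weight steeper than that of a facet whose jet has a term linear in `x` does not define a facet
of a series divisible by `x`. -/
theorem not_isFacetWeight_of_lt {i j : Fin 2} (hij : i ≠ j) {g : MvPowerSeries (Fin 2) ℂ}
    (hgi : ∀ m, coeff m g ≠ 0 → m i ≠ 0) {w : Fin 2 → ℕ} (hwj : w j = 1) {m₁ : Fin 2 →₀ ℕ}
    (hm₁ : coeff m₁ g ≠ 0) (hm₁i : m₁ i = 1) (hgd : g ∈ weightIdeal w (Finsupp.weight w m₁))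
    {w' : Fin 2 → ℕ} {d' : ℕ} (hlt : w i * w' j < w' i) : ¬ IsFacetWeight g w' d' := by
  rintro ⟨hw', -, hg', m, m', hmm, hm, hm', hmd, hmd'⟩
  have key : ∀ n, coeff n g ≠ 0 → Finsupp.weight w' n = d' → n = m₁ := by
    intro n hn hnd
    obtain ⟨t, ht⟩ := Nat.exists_eq_succ_of_ne_zero (hgi n hn)
    have h1 := hgd n hn
    have h2 := hg' m₁ hm₁
    rw [← hnd] at h2
    rw [weight_fin_two w _ hij, weight_fin_two w _ hij, hwj, hm₁i, ht] at h1
    rw [weight_fin_two w' _ hij, weight_fin_two w' _ hij, hm₁i, ht] at h2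
    -- Here t = n_i - 1 measures the excess over degree one in x_i. Multiplying by w'_j and
    -- comparing with the w'-minimality of n gives w'_i t ≤ w_i w'_j t, so t = 0.
    have h3 : m₁ j ≤ w i * t + n j := by
      rw [Nat.succ_eq_add_one, mul_add] at h1
      omega
    have h4 := Nat.mul_le_mul_left (w' j) h3
    have h5 : (w i * w' j + 1) * t ≤ w' i * t := Nat.mul_le_mul_right t hlt
    have ht0 : t = 0 := by nlinarith
    subst ht0
    refine finsupp_ext_fin_two hij (ht.trans hm₁i.symm) (le_antisymm ?_ (by simpa using h3))
    exact Nat.le_of_mul_le_mul_left (by omega) (hw' j)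
  exact hmm ((key m hm hmd).trans (key m' hm' hmd').symm)

/-- Straightening a smooth branch of a non-degenerate germ. -/
theorem exists_straightening {i j : Fin 2} (hij : i ≠ j) {f : ConvergentSeries}
    (hnd : HasNondegenerateFacets f)
    (hs : HasSmoothFacetAt (f : MvPowerSeries (Fin 2) ℂ) i) :
    ∃ g : ConvergentSeries, RightEquivalent f g ∧ HasNondegenerateFacets g ∧
      (∀ m, coeff m (g : MvPowerSeries (Fin 2) ℂ) ≠ 0 → m i ≠ 0) ∧
      ((∀ m, coeff m (f : MvPowerSeries (Fin 2) ℂ) ≠ 0 → m j ≠ 0) →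
        ∀ m, coeff m (g : MvPowerSeries (Fin 2) ℂ) ≠ 0 → m j ≠ 0) := by
  obtain ⟨w, d, hwd, hwj, m₀, hm₀, hm₀d, hm₀i⟩ := hs
  replace hwj : w j = 1 := hwj j hij.symm
  have hw := hwd.1
  have hfd := hwd.2.2.1
  rw [hasNondegenerateFacets_iff] at hnd
  obtain ⟨h, hsat, hM⟩ := hnd w d hwd
  have hnu : ¬ IsUnit h := by
    obtain ⟨⟨k, l, hkl⟩, -⟩ := hsat
    exact not_isUnit_of_isSaturation hwd hkl
  obtain ⟨n, hn⟩ : ∃ n, MvPolynomial.IsWeightedHomogeneous w h n := by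
    obtain ⟨⟨k, l, hkl⟩, hX, -⟩ := hsat
    exact isWeightedHomogeneous_of_isSaturation hwd hkl (by rintro rfl; exact hX (dvd_zero _))
  obtain ⟨⟨a, l, hF⟩, hXi, hXj⟩ := hsat.exists_eq hij
  -- The facet reaches x_i-exponent 0, at `m₀`, so x_i does not divide the jet.
  have ha : a = 0 := by
    by_contra ha
    have hdvd : MvPolynomial.X i ∣ weightedJet w d (f : MvPowerSeries (Fin 2) ℂ) := by
      rw [hF, mul_assoc]
      exact (dvd_pow_self _ ha).mul_right _
    exact X_dvd_iff_coeff.mp hdvd m₀ (by rwa [coeff_weightedJet hw, if_pos hm₀d]) hm₀i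
  rw [ha, pow_zero, one_mul] at hF
  obtain ⟨P, hPj, hP, hP'⟩ := exists_simple_zero hij hw hn hnu hXj hM
  have hFP : MvPolynomial.eval P (weightedJet w d (f : MvPowerSeries (Fin 2) ℂ)) = 0 := by
    rw [hF, map_mul, hP, mul_zero]
  have hFP' : MvPolynomial.eval P
      (MvPolynomial.pderiv i (weightedJet w d (f : MvPowerSeries (Fin 2) ℂ))) ≠ 0 := by
    rw [hF, Derivation.leibniz, Derivation.leibniz_pow, MvPolynomial.pderiv_X_of_ne hij.symm]
    simpa [hPj] using hP'
  obtain ⟨u, huc, hu0, hui, hfu⟩ := exists_smooth_branch hij f.2 hw hwj hfd hPj hFP hFP'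
  set α := w i
  have hα0 : α ≠ 0 := (hw i).ne'
  set φ : MvPowerSeries (Fin 2) ℂ := X j ^ α * (C (P i) + u) with hφ
  have hφ0 : constantCoeff φ = 0 := by simp [hφ, hα0]
  have hφi : ∀ m, coeff m φ ≠ 0 → m i = 0 := by
    have hsum : ∀ m, coeff m (C (P i) + u) ≠ 0 → m i = 0 := by
      classical
      intro m hm
      rw [map_add, coeff_C] at hm
      by_cases hm0 : m = 0
      · simp [hm0]
      · rw [if_neg hm0, zero_add] at hm
        exact hui m hm
    classical
    intro m hm
    rw [hφ, X_pow_eq, coeff_monomial_mul] at hm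
    split_ifs at hm with hle
    · rw [one_mul] at hm
      simpa [hij] using hsum _ hm
    · exact absurd rfl hm
  have hφc : IsConvergent φ := isConvergent_mul (isConvergent_pow (isConvergent_X j) _)
    (isConvergent_add (isConvergent_C _) huc)
  have hφw : ∀ w' : Fin 2 → ℕ, φ ∈ weightIdeal w' (α * w' j) := fun w' =>
    Ideal.mul_mem_right _ _ (pow_mem_weightIdeal (X_mem_weightIdeal w' j) α)
  let g := shearEquiv hij ⟨φ, hφc⟩ hφ0 hφi f
  have hg : (g : MvPowerSeries (Fin 2) ℂ) = subst (shearVec i φ) (f : MvPowerSeries (Fin 2) ℂ) :=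
    coe_shearEquiv hij ⟨φ, hφc⟩ hφ0 hφi f
  have hgi : ∀ m, coeff m (g : MvPowerSeries (Fin 2) ℂ) ≠ 0 → m i ≠ 0 := fun m hm =>
    ne_zero_of_coeff_subst_shearVec_ne_zero hij hφ0 hφi hfu (by rwa [hg] at hm)
  refine ⟨g, ⟨_, rfl⟩, ?_, hgi, fun hfj m hm =>
    ne_zero_of_coeff_subst_shearVec_ne_zero' hij hφ0 hfj (by rwa [hg] at hm)⟩
  have hsφ := hasSubst_shearVec (i := i) hφ0
  have hφwi : φ ∈ weightIdeal w (w i) := by simpa [hwj] using hφw w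
  have hgd : (g : MvPowerSeries (Fin 2) ℂ) ∈ weightIdeal w d := by
    rw [hg]
    exact subst_mem_weightIdeal_of_weight hsφ (shearVec_mem_weightIdeal hφwi) hfd
  set F' := MvPolynomial.aeval (polyShear i j (P i) α)
    (weightedJet w d (f : MvPowerSeries (Fin 2) ℂ)) with hF'
  have hjet : weightedJet w d (g : MvPowerSeries (Fin 2) ℂ) = F' := by
    have hcX : (C (P i) * X j ^ α : MvPowerSeries (Fin 2) ℂ) ∈ weightIdeal w (w i) := by
      have := pow_mem_weightIdeal (X_mem_weightIdeal w j) α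
      rw [hwj, mul_one] at this
      exact C_mul_mem_weightIdeal _ this
    have hc0 : constantCoeff (C (P i) * X j ^ α : MvPowerSeries (Fin 2) ℂ) = 0 := by
      simp [hα0]
    have hs0 := hasSubst_shearVec (i := i) hc0
    have huw : u ∈ weightIdeal w 1 := by
      intro m hm
      have h1 := mem_weightIdeal_single_iff.mp (mem_weightIdeal_single_one hij hui hu0) m hm
      rw [weight_fin_two w m hij, hwj]
      omega
    have hcong := subst_sub_subst_weightedJet_mem hw hsφ hs0 (shearVec_mem_weightIdeal hφwi)
      (shearVec_mem_weightIdeal hcX) (fun k => by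
        rcases eq_or_ne k i with rfl | hk
        · rw [shearVec_self, shearVec_self, add_sub_add_left_eq_sub, hφ]
          have h1 : X j ^ α * (C (P k) + u) - C (P k) * X j ^ α = X j ^ α * u := by ring
          have h2 := pow_mem_weightIdeal (X_mem_weightIdeal w j) α
          rw [hwj, mul_one] at h2
          rw [h1]
          exact mul_mem_weightIdeal h2 huw
        · rw [shearVec_of_ne hk, shearVec_of_ne hk, sub_self]
          exact zero_mem _) hfd
    rw [← hg, ← coe_aeval_polyShear] at hcong
    rw [weightedJet_eq_of_sub_mem hw hcong]
    exact weightedJet_coe hw (isWeightedHomogeneous_aeval (isWeightedHomogeneous_polyShear hwj)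
      (isWeightedHomogeneous_weightedJet hw d _))
  have hF'coeff : ∀ m, MvPolynomial.coeff m F' ≠ 0 →
      coeff m (g : MvPowerSeries (Fin 2) ℂ) ≠ 0 ∧ Finsupp.weight w m = d := by
    intro m hm
    rw [← hjet, coeff_weightedJet hw] at hm
    split_ifs at hm with hmd
    · exact ⟨hm, hmd⟩
    · exact absurd rfl hm
  have hXF' : MvPolynomial.X i ∣ F' := X_dvd_iff_coeff.mpr fun m hm => hgi m (hF'coeff m hm).1
  -- The polynomial shear sends the point with x_i = 0, x_j = 1 to P. Simplicity of the zero makes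
  -- ∂_i F' nonzero there, which yields a monomial of degree one in x_i. It blocks steeper facets
  -- and shows that x_i divides F' exactly once.
  obtain ⟨m₁, hm₁, hm₁i⟩ : ∃ m, MvPolynomial.coeff m F' ≠ 0 ∧ m i = 1 := by
    have hev : (fun k => MvPolynomial.eval (Pi.single j 1) (polyShear i j (P i) α k)) = P := by
      funext k
      rcases eq_or_ne k i with rfl | hk
      · simp [polyShear, hij]
      · obtain rfl : k = j := by omega
        simp [polyShear, hk, hPj]
    have hder : MvPolynomial.eval (Pi.single j 1) (MvPolynomial.pderiv i F') ≠ 0 := by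
      rw [hF', pderiv_aeval, map_sum, Finset.sum_eq_single i]
      · rw [map_mul, eval_aeval, hev, polyShear, Function.update_self]
        simpa [MvPolynomial.pderiv_X_of_ne hij.symm] using hFP'
      · intro k _ hk
        rw [polyShear, Function.update_of_ne hk, MvPolynomial.pderiv_X_of_ne hk, mul_zero, map_zero]
      · simp
    have hndvd : ¬ MvPolynomial.X i ∣ MvPolynomial.pderiv i F' := by
      rintro ⟨q, hq⟩
      rw [hq, map_mul, MvPolynomial.eval_X, Pi.single_eq_of_ne hij, zero_mul] at hder
      exact hder rfl
    obtain ⟨m, hm, hmi⟩ := exists_coeff_ne_zero_of_not_X_dvd hndvd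
    rw [← MvPolynomial.coeff_coe, ← pderiv_coe, coeff_pderiv, MvPolynomial.coeff_coe] at hm
    exact ⟨_, left_ne_zero_of_mul hm, by simp [hmi]⟩
  obtain ⟨hm₁g, hm₁d⟩ := hF'coeff m₁ hm₁
  rw [hasNondegenerateFacets_iff]
  intro w' d' hwd'
  -- Compares the w'-weight of x_i with that of x_j^α, the power of x_j extracted from φ. In the
  -- first case the inverse shear is of higher order and brings the facet and its jet back to f.
  rcases lt_trichotomy (w' i) (α * w' j) with hlt | heq | hlt
  · have hneg0 : constantCoeff (-φ) = 0 := by rw [map_neg, hφ0, neg_zero]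
    have hψ : -φ ∈ weightIdeal w' (w' i + 1) := neg_mem (weightIdeal_anti hlt (hφw w'))
    obtain ⟨h1, h2⟩ := isFacetWeight_of_subst_shearVec hneg0 hψ hwd'
    rw [hg, subst_shearVec_subst_shearVec hij hφ0 hneg0 hφi (add_neg_cancel φ)] at h1 h2
    rw [hg, ← h2]
    exact hnd w' d' h1
  · have hcop : (w' i).Coprime (w' j) := by
      have h := hwd'.2.1
      have hor : (i = 0 ∧ j = 1) ∨ (i = 1 ∧ j = 0) := by omega
      rcases hor with ⟨rfl, rfl⟩ | ⟨rfl, rfl⟩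
      · exact h
      · exact h.symm
    have hw'j : w' j = 1 := Nat.eq_one_of_dvd_coprimes hcop ⟨α, by rw [heq, mul_comm]⟩ dvd_rfl
    have hw'w : w' = w := by
      funext k
      rcases eq_or_ne k i with rfl | hk
      · rw [heq, hw'j, mul_one]
      · obtain rfl : k = j := by omega
        rw [hw'j, hwj]
    subst hw'w
    have hdd : d' = d := by
      obtain ⟨-, -, hgd', m, -, -, hm, -, hmd, -⟩ := hwd'
      exact le_antisymm (hm₁d ▸ hgd' m₁ hm₁g) (hmd ▸ hgd m hm)
    subst hdd
    have hF'h : F' = MvPolynomial.X j ^ l * MvPolynomial.aeval (polyShear i j (P i) α) h := by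
      rw [hF', hF, map_mul, map_pow, aeval_polyShear_X hij]
    obtain ⟨s, hs⟩ : MvPolynomial.X i ∣ MvPolynomial.aeval (polyShear i j (P i) α) h := by
      rw [hF'h] at hXF'
      exact ((MvPolynomial.X_prime (R := ℂ) (i := i)).dvd_or_dvd hXF').resolve_left
        (not_X_dvd_X_pow hij l)
    have hF's : F' = MvPolynomial.X i ^ 1 * MvPolynomial.X j ^ l * s := by
      rw [hF'h, hs]
      ring
    have hsi : ¬ MvPolynomial.X i ∣ s := by
      rintro ⟨q, rfl⟩
      have hF'q : F' = MvPolynomial.X i * (MvPolynomial.X i * (MvPolynomial.X j ^ l * q)) := by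
        rw [hF's]
        ring
      rw [hF'q, MvPolynomial.coeff_X_mul'] at hm₁
      split_ifs at hm₁
      · exact X_dvd_iff_coeff.mp (Dvd.intro _ rfl) _ hm₁ (by simp [hm₁i])
      · exact hm₁ rfl
    -- The inverse shear fixes x_j, so a factor x_j of s would already divide h.
    have hsj : ¬ MvPolynomial.X j ∣ s := by
      intro hdvd
      have h1 := map_dvd (MvPolynomial.aeval (polyShear i j (-P i) α)) (hdvd.mul_left
        (MvPolynomial.X i))
      rw [← hs, aeval_polyShear_neg hij, aeval_polyShear_X hij] at h1
      exact hXj h1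
    have hsat' : IsSaturation (weightedJet w' d' (g : MvPowerSeries (Fin 2) ℂ)) s :=
      isSaturation_of_eq hij (hjet.trans hF's) hsi hsj
    have hs0 : s ≠ 0 := by rintro rfl; exact hsi (dvd_zero _)
    obtain ⟨⟨k', l', hkl'⟩, -⟩ := id hsat'
    obtain ⟨D, hD⟩ := isWeightedHomogeneous_of_isSaturation hwd' hkl' hs0
    -- Weighted degree 0 would make s constant, so the jet of g would be a monomial. The nonzero
    -- degree is what Euler's relation needs.
    have hD0 : D ≠ 0 := by
      rintro rfl
      refine not_isUnit_of_isSaturation hwd' hkl' ?_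
      have h1 := eq_C_of_isWeightedHomogeneous_zero hw hD
      rw [h1] at hs0 ⊢
      exact (isUnit_iff_ne_zero.mpr fun h0 => hs0 (by rw [h0, map_zero])).map MvPolynomial.C
    exact ⟨s, hsat', hasFiniteMilnorNumber_of_aeval_polyShear hij (hw i) hD0 hD hs hM⟩
  · exact absurd hwd' (not_isFacetWeight_of_lt hij hgi hwj hm₁g hm₁i (by rwa [hm₁d]) hlt)

theorem not_hasSmoothFacetAt {i : Fin 2} {f : MvPowerSeries (Fin 2) ℂ}
    (h : ∀ m, coeff m f ≠ 0 → m i ≠ 0) : ¬ HasSmoothFacetAt f i := by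
  rintro ⟨w, d, -, -, m, hm, -, hmi⟩
  exact h m hm hmi

/-- A germ with non-degenerate facets has a right equivalent one without smooth facets at the
axes. -/
theorem exists_rightEquivalent_not_hasSmoothFacetAt {f : ConvergentSeries}
    (hnd : HasNondegenerateFacets f) : ∃ g : ConvergentSeries, RightEquivalent f g ∧
      HasNondegenerateFacets g ∧
      ∀ i, ¬ HasSmoothFacetAt (g : MvPowerSeries (Fin 2) ℂ) i := by
  by_cases hs : ∃ i, HasSmoothFacetAt (f : MvPowerSeries (Fin 2) ℂ) i
  · obtain ⟨i, hi⟩ := hs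
    obtain ⟨j, hij⟩ : ∃ j, i ≠ j := ⟨i + 1, by fin_cases i <;> simp⟩
    obtain ⟨g, ⟨φ, hφ⟩, hg, hgi, -⟩ := exists_straightening hij hnd hi
    by_cases hj : HasSmoothFacetAt (g : MvPowerSeries (Fin 2) ℂ) j
    · obtain ⟨g', ⟨φ', hφ'⟩, hg', hgj', hgi'⟩ := exists_straightening hij.symm hg hj
      refine ⟨g', ⟨φ.trans φ', by rw [AlgEquiv.trans_apply, hφ, hφ']⟩, hg', fun k => ?_⟩
      rcases eq_or_ne k i with rfl | hk
      · exact not_hasSmoothFacetAt (hgi' hgi)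
      · obtain rfl : k = j := by omega
        exact not_hasSmoothFacetAt hgj'
    · refine ⟨g, ⟨φ, hφ⟩, hg, fun k => ?_⟩
      rcases eq_or_ne k i with rfl | hk
      · exact not_hasSmoothFacetAt hgi
      · obtain rfl : k = j := by omega
        exact hj
  · exact ⟨f, ⟨AlgEquiv.refl, rfl⟩, hnd, fun i hi => hs ⟨i, hi⟩⟩

end ConvergentSeries

theorem mainTheorem11 (f : ConvergentSeries) (hf : f ∈ ConvergentSeries.maxIdeal ^ 2)
    (hnd : ConvergentSeries.HasNondegenerateNewtonBoundary f) :
    ∃ g : ConvergentSeries, ConvergentSeries.RightEquivalent f g ∧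
      ConvergentSeries.HasNondegenerateFacets g ∧
      ∀ Δ : Set (Fin 2 → ℝ), ConvergentSeries.IsFacet g Δ →
        ConvergentSeries.IsNormalizedAt g Δ := by
  obtain ⟨g, hfg, hg, hs⟩ :=
    ConvergentSeries.exists_rightEquivalent_not_hasSmoothFacetAt hnd.2
  exact ⟨g, hfg, hg, fun _ hΔ =>
    ConvergentSeries.isNormalizedAt_of_not_hasSmoothFacetAt hg hs hΔ⟩
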